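/- **Setting.** Let $n\ge 2$ and let $\Omega\subset\mathbb R^n$ be a bounded domain (bounded, open, connected, non-empty). A generalized N-function on $S$ is a function $G:S\times\mathbb R\to\mathbb R$ such that: for a.e. $x$, $G(x,\cdot)$ is even, continuous, convex and increasing on $[0,\infty)$, with $G(x,t)/t\to0$ as $t\to0$ and $G(x,t)/t\to\infty$ as $t\to\infty$; $G(\cdot,t)$ is measurable for each $t$; and $G(x,t)>0=G(x,0)$ for all $x$ and all $t>0$. Its density $g(x,\cdot)$ is the right-hand derivative of $G(x,\cdot)$ on $[0,\infty)$, so that $G(x,t)=\int_0^{|t|}g(x,s)\,ds$. Write $\widetilde G(x,t)=\sup_{s\ge0}(ts-G(x,s))$ for the complementary function; $G^{-1},\widetilde G^{-1}$ are inverses in $t\ge 0$. The Sobolev conjugate is $G^*(x,t)=G(x,N^{-1}(x,t))$ with $N(x,t)=\Big(\int_0^t\big(\tfrac{\tau}{G(x,\tau)}\big)^{\frac1{n-1}}d\tau\Big)^{\frac{n-1}{n}}$. *Conditions on $G$* (a generalized N-function on $\mathbb R^n$): - (G0) $1<g^-\le g^+<n$ and $g^-\le \dfrac{g(x,t)t}{G(x,t)}\le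 g^+$ for all $x\in\mathbb R^n$, $t>0$. - (G1) $F\ge1$ and $F^{-1}\le G(x,1)\le F$ for a.e. $x\in\mathbb R^n$. - (G2) There is $\mu\in(0,1]$ such that $\mu G^{-1}(x,t)\le G^{-1}(y,t)$ for every ball $B$ with $|B|\le1$, every $t\in[1,1/|B|]$ and a.e. $x,y\in B$. - (G3) For every $x_0\in\Omega$ there is $L_0>1$ such that for all sufficiently small $R>0$, all $t>1$ and all $x,y\in B_R(x_0)$: $|r(x,t)-r(y,t)|\le L_0/|\ln(2R)|$, where $r(x,t)=tg(x,t)/G(x,t)$. *Conditions on $H_1,H_2$.* For $i=1,2$, $H_i$ is a generalized N-function with density $h_i$; there are constants $F_i>1$ and $h_i^-,h_i^+$ with $F_i^{-1}\le H_i(x,1)\le F_i$ and $g^+\le h_i^-\le \dfrac{h_i(x,t)t}{H_i(x,t)}\le h_i^+$ for all $x\in\Omega$, $t>0$; $\int_\Omega H_i(x,t)\,dx<\infty$ for $t>0$; and $G\prec H_i\prec\prec G^*$. Here $G_1\prec G_2$ means $G_1(x,t)\le C_1G_2(x,C_2t)+\varphi(x)$ for a.e. $x\in\Omega$ and all $t\ge0$,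 for some $C_1,C_2>0$ and $0\le\varphi\in L^1(\Omega)$; and $G_1\prec\prec G_2$ means $G_1(x,kt)/G_2(x,t)\to0$ as $t\to\infty$, uniformly in $x\in\Omega$, for each $k>0$. *Structure conditions.* $A:\Omega\times\mathbb R\times\mathbb R^n\to\mathbb R^n$, $B:\Omega\times\mathbb R\times\mathbb R^n\to\mathbb R$ and $C:\partial\Omega\times\mathbb R\to\mathbb R$ are Carathéodory functions, and with positive constants $a_1,\dots,a_6,b_1,b_2,b_3,c_1,c_2$, $$A(x,u,\eta)\cdot\eta\ge a_4G(x,|\eta|)-a_5H_1(x,|u|)-a_6,\qquad |A(x,u,\eta)|\le a_1g(x,|\eta|)+a_2P(x,|u|)+a_3,$$ $$|B(x,u,\eta)|\le b_1M(x,|\eta|)+b_2h_1(x,|u|)+b_3,\qquad |C(x,u)|\le c_1h_2(x,|u|)+c_2,$$ where $M(x,t)=\widetilde{H_1}^{-1}(x,G(x,t))$ and $P(x,t)=\widetilde G^{-1}(x,H_1(x,t))$. *Weak solutions.* $W^{1,G(x,t)}(\Omega)$ consists of the measurable $u$ with weak gradient $Du$ such that $\int_\Omega G(x,\lambda u)\,dx<\infty$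 and $\int_\Omega G(x,\lambda|Du|)\,dx<\infty$ for some $\lambda>0$. Let $\sigma$ be the surface measure on $\partial\Omega$ (normalized $(n-1)$-dimensional Hausdorff measure). The trace of $u$ (again written $u$) is the function on $\partial\Omega$ with $\lim_{r\to0}\frac{1}{|B_r(x)\cap\Omega|}\int_{B_r(x)\cap\Omega}|u(y)-u(x)|\,dy=0$ for $\sigma$-a.e. $x\in\partial\Omega$ (on a Lipschitz domain this is the usual trace). A function $u\in W^{1,G(x,t)}(\Omega)$ possessing a trace is a weak solution of $$\operatorname{div}A(x,u,Du)+B(x,u,Du)=0\ \text{in }\Omega,\qquad A(x,u,Du)\cdot\nu=C(x,u)\ \text{on }\partial\Omega\tag{PN}$$ if $\int_\Omega A(x,u,Du)\cdot Dv\,dx-\int_{\partial\Omega}C(x,u)v\,d\sigma-\int_\Omega B(x,u,Du)v\,dx=0$ for all $v\in W^{1,G(x,t)}(\Omega)$ (possessing a trace). *De Giorgi classes.* Let $M,\gamma,\gamma_1,\delta>0$, $\delta\le2$; maxima are essential suprema, balls $B_\rho$, $B_{\rho-\sigma\rho}$ are concentric, and $A_{k,\rho}=\{x\in B_\rho\cap\Omega: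 w(x)>k\}$. Then $u\in\mathcal B_{G(x,t)}(\Omega,M,\gamma,\gamma_1,\delta)$ means that $u\in W^{1,G(x,t)}(\Omega)$, $\max_\Omega|u|\le M$, and for $w=\pm u$ $$\int_{A_{k,\rho-\sigma\rho}}G(x,|Dw|)\,dx\le\gamma\int_{A_{k,\rho}}G\Big(x,\Big|\frac{w-k}{\sigma\rho}\Big|\Big)dx+\gamma_1|A_{k,\rho}|\tag{1}$$ for all balls $B_\rho\subset\Omega$, $\sigma\in(0,1)$ and $k\ge\max_{B_\rho}w-\delta M$. And $u\in\mathcal B_{G(x,t)}(\overline\Omega,M,\gamma,\gamma_1,\delta)$ means that in addition (1) holds for $w=\pm u$, all balls $B_\rho$ with $B_\rho\cap\partial\Omega\ne\emptyset$, all $\sigma\in(0,1)$ and all $k\ge\max\{\max_{B_\rho\cap\Omega}w-\delta M,\ \max_{B_\rho\cap\partial\Omega}w\}$, with $w$ on $\partial\Omega$ understood as the trace. **Theorem.** Under all the conditions above, let $u\in W^{1,G(x,t)}(\Omega)$ be a weak solution of (PN) with $\max_{x\in\Omega}|u(x)|\le M$, where $M>0$. Then $u\in\mathcal B_{G(x,t)}(\overline\Omega,M,\gamma,\gamma_1,\delta)$,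 where $$\delta=\min\Big\{\frac{a_4}{4b_3M},2\Big\},\qquad \gamma=\gamma(a_1,a_2,a_3,a_4,g^-,g^+),$$ $$\gamma_1=\gamma_1(a_1,a_2,a_3,a_4,a_5,a_6,b_1,b_2,b_3,c_1,c_2,g^+,h_1^+,F,F_1,M),$$ that is, $\gamma$ and $\gamma_1$ are positive constants depending only on the listed quantities. -/

import Mathlib

open MeasureTheory Set Filter Topology
open scoped ENNReal

noncomputable section

namespace DGNeumann

/-- Euclidean space `ℝⁿ`. -/
abbrev E (n : ℕ) : Type := EuclideanSpace ℝ (Fin n)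

/-- Bounded domain: bounded, open, connected (in particular non-empty). -/
structure IsBoundedDomain {n : ℕ} (Ω : Set (E n)) : Prop where
  isOpen : IsOpen Ω
  isConnected : IsConnected Ω
  isBounded : Bornology.IsBounded Ω

/-! ### Generalized N-functions -/

/-- `G : S × ℝ → ℝ` is a generalized N-function. -/
structure IsGenNFunction {n : ℕ} (S : Set (E n)) (G : E n → ℝ → ℝ) : Prop where
  even : ∀ᵐ x ∂(volume.restrict S), ∀ t, G x (-t) = G x t
  continuous : ∀ᵐ x ∂(volume.restrict S), Continuous (G x)
  increasing : ∀ᵐ x ∂(volume.restrict S), MonotoneOn (G x) (Ici 0)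
  convex : ∀ᵐ x ∂(volume.restrict S), ConvexOn ℝ univ (G x)
  measurable : ∀ t, AEMeasurable (fun x => G x t) (volume.restrict S)
  lim_zero : ∀ᵐ x ∂(volume.restrict S), Tendsto (fun t => G x t / t) (𝓝[≠] 0) (𝓝 0)
  lim_infty : ∀ᵐ x ∂(volume.restrict S), Tendsto (fun t => G x t / t) atTop atTop
  pos : ∀ x ∈ S, ∀ t, 0 < t → 0 < G x t
  zero : ∀ x ∈ S, G x 0 = 0

/-- The density `g` of `G`: the right-hand derivative of `G(x, ·)` at `t ≥ 0`, extended as an odd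
function; for a generalized N-function, `G(x,t) = ∫₀^{|t|} g(x,s) ds`. -/
def dens {n : ℕ} (G : E n → ℝ → ℝ) (x : E n) (t : ℝ) : ℝ :=
  if 0 ≤ t then derivWithin (G x) (Ici t) t else -derivWithin (G x) (Ici (-t)) (-t)

/-- The complementary function `G̃(x,t) = sup_{s ≥ 0} (t s - G(x,s))`. -/
def compl {n : ℕ} (G : E n → ℝ → ℝ) (x : E n) (t : ℝ) : ℝ :=
  sSup ((fun s => t * s - G x s) '' Ici 0)

/-- Inverse on `[0,∞)`: for `f` continuous and strictly increasing from `[0,∞)` onto `[0,∞)` and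
`t ≥ 0` this is the unique `s ≥ 0` with `f s = t`. -/
def inv (f : ℝ → ℝ) (t : ℝ) : ℝ := sSup {s | 0 ≤ s ∧ f s ≤ t}

/-- `N(x,t) = (∫₀ᵗ (τ / G(x,τ))^{1/(n-1)} dτ)^{(n-1)/n}`. -/
def sobN {n : ℕ} (G : E n → ℝ → ℝ) (x : E n) (t : ℝ) : ℝ :=
  (∫ τ in (0 : ℝ)..t, (τ / G x τ) ^ (1 / ((n : ℝ) - 1))) ^ (((n : ℝ) - 1) / n)

/-- The Sobolev conjugate `G*(x,t) = G(x, N⁻¹(x,t))`, `t ≥ 0`. -/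
def sobConj {n : ℕ} (G : E n → ℝ → ℝ) (x : E n) (t : ℝ) : ℝ :=
  G x (inv (sobN G x) t)

/-- `G₁ ≺ G₂`: `G₁` is weaker than `G₂`. -/
def Weaker {n : ℕ} (Ω : Set (E n)) (G₁ G₂ : E n → ℝ → ℝ) : Prop :=
  ∃ C₁ C₂ : ℝ, 0 < C₁ ∧ 0 < C₂ ∧ ∃ φ : E n → ℝ, (∀ x ∈ Ω, 0 ≤ φ x) ∧ IntegrableOn φ Ω ∧
    ∀ᵐ x ∂(volume.restrict Ω), ∀ t, 0 ≤ t → G₁ x t ≤ C₁ * G₂ x (C₂ * t) + φ x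

/-- `G₁ ≺≺ G₂`: `G₁` increases essentially slower than `G₂` near infinity. -/
def EssSlower {n : ℕ} (Ω : Set (E n)) (G₁ G₂ : E n → ℝ → ℝ) : Prop :=
  ∀ k : ℝ, 0 < k →
    TendstoUniformlyOn (fun t x => G₁ x (k * t) / G₂ x t) (fun _ => 0) atTop Ω

/-! ### Conditions on `G` and on `H₁`, `H₂` -/

def CondG0 {n : ℕ} (G : E n → ℝ → ℝ) (gm gp : ℝ) : Prop :=
  1 < gm ∧ gm ≤ gp ∧ gp < n ∧
    ∀ x t, 0 < t → gm ≤ dens G x t * t / G x t ∧ dens G x t * t / G x t ≤ gp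

def CondG1 {n : ℕ} (G : E n → ℝ → ℝ) (F : ℝ) : Prop :=
  1 ≤ F ∧ ∀ᵐ x ∂(volume : Measure (E n)), F⁻¹ ≤ G x 1 ∧ G x 1 ≤ F

def CondG2 {n : ℕ} (G : E n → ℝ → ℝ) : Prop :=
  ∃ μ : ℝ, 0 < μ ∧ μ ≤ 1 ∧ ∀ (z : E n) (r : ℝ), 0 < r → volume (Metric.ball z r) ≤ 1 →
    ∀ t : ℝ, 1 ≤ t → t ≤ 1 / (volume (Metric.ball z r)).toReal →
      ∀ᵐ x ∂(volume.restrict (Metric.ball z r)), ∀ᵐ y ∂(volume.restrict (Metric.ball z r)),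
        μ * inv (G x) t ≤ inv (G y) t

/-- Logarithmic modulus of continuity of `r(x,t) = t g(x,t) / G(x,t)` in `x`. -/
def CondG3 {n : ℕ} (Ω : Set (E n)) (G : E n → ℝ → ℝ) : Prop :=
  ∀ x₀ ∈ Ω, ∃ L₀ : ℝ, 1 < L₀ ∧ ∀ᶠ R in 𝓝[>] (0 : ℝ), ∀ t : ℝ, 1 < t →
    ∀ x ∈ Metric.ball x₀ R, ∀ y ∈ Metric.ball x₀ R,
      |t * dens G x t / G x t - t * dens G y t / G y t| ≤ L₀ / |Real.log (2 * R)|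

/-- Conditions on `H = Hᵢ`, with constants `F = Fᵢ`, `hm = hᵢ⁻`, `hp = hᵢ⁺`. -/
structure CondH {n : ℕ} (Ω : Set (E n)) (G : E n → ℝ → ℝ) (gp : ℝ) (H : E n → ℝ → ℝ)
    (F hm hp : ℝ) : Prop where
  genN : IsGenNFunction Ω H
  one_lt_F : 1 < F
  H1 : ∀ x ∈ Ω, F⁻¹ ≤ H x 1 ∧ H x 1 ≤ F
  gp_le : gp ≤ hm
  H2 : ∀ x ∈ Ω, ∀ t, 0 < t → hm ≤ dens H x t * t / H x t ∧ dens H x t * t / H x t ≤ hp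
  H3 : ∀ t, 0 < t → IntegrableOn (fun x => H x t) Ω
  H4_weaker : Weaker Ω G H
  H4_slower : EssSlower Ω H (sobConj G)

/-! ### Musielak–Orlicz–Sobolev functions -/

/-- `f ∈ L^{G(x,t)}(Ω)`. -/
def MemL {n : ℕ} (Ω : Set (E n)) (G : E n → ℝ → ℝ) (f : E n → ℝ) : Prop :=
  AEMeasurable f (volume.restrict Ω) ∧
    ∃ l : ℝ, 0 < l ∧ ∫⁻ x in Ω, ENNReal.ofReal (G x (l * f x)) < ⊤

/-- `Du` is the weak (distributional) gradient of `u` in `Ω`. -/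
structure IsWeakGradient {n : ℕ} (Ω : Set (E n)) (u : E n → ℝ) (Du : E n → E n) : Prop where
  locInt : LocallyIntegrableOn u Ω
  locInt_grad : LocallyIntegrableOn Du Ω
  parts : ∀ φ : E n → ℝ, ContDiff ℝ (⊤ : ℕ∞) φ → HasCompactSupport φ → tsupport φ ⊆ Ω → ∀ e : E n,
    ∫ x in Ω, u x * fderiv ℝ φ x e = -∫ x in Ω, inner ℝ (Du x) e * φ x

/-- `u ∈ W^{1,G(x,t)}(Ω)`, with weak gradient `Du`. -/
structure MemW {n : ℕ} (Ω : Set (E n)) (G : E n → ℝ → ℝ) (u : E n → ℝ) (Du : E n → E n) :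
    Prop where
  mem : MemL Ω G u
  grad : IsWeakGradient Ω u Du
  mem_grad : MemL Ω G (fun x => ‖Du x‖)

/-- Surface measure `σ` on `∂Ω`: the normalized `(n-1)`-dimensional Hausdorff measure. -/
def surf {n : ℕ} (Ω : Set (E n)) : Measure (E n) :=
  (Measure.euclideanHausdorffMeasure (n - 1)).restrict (frontier Ω)

/-- `τ` is the trace of `u` on `∂Ω`: at `σ`-almost every boundary point `x`, the averages of
`|u - τ(x)|` over `B_r(x) ∩ Ω` tend to `0` as `r → 0`.  This determines `τ` up to `σ`-null sets. -/
def IsTrace {n : ℕ} (Ω : Set (E n)) (u τ : E n → ℝ) : Prop :=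
  ∀ᵐ x ∂(surf Ω),
    Tendsto (fun r : ℝ => ⨍⁻ y in Metric.ball x r ∩ Ω, ENNReal.ofReal |u y - τ x| ∂volume)
      (𝓝[>] 0) (𝓝 0)

/-! ### The De Giorgi type classes -/

/-- The energy inequality for `w` on the level sets `A_{k,r} = {x ∈ B_r(z) ∩ Ω : w(x) > k}`,
`r = ρ - σρ` and `r = ρ`. -/
def EnergyIneq {n : ℕ} (Ω : Set (E n)) (G : E n → ℝ → ℝ) (γ γ₁ : ℝ) (w : E n → ℝ)
    (Dw : E n → E n) (z : E n) (ρ σ k : ℝ) : Prop :=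
  ∫⁻ x in {x | x ∈ Metric.ball z (ρ - σ * ρ) ∩ Ω ∧ k < w x}, ENNReal.ofReal (G x ‖Dw x‖) ≤
    ENNReal.ofReal γ *
        (∫⁻ x in {x | x ∈ Metric.ball z ρ ∩ Ω ∧ k < w x},
          ENNReal.ofReal (G x |(w x - k) / (σ * ρ)|)) +
      ENNReal.ofReal γ₁ * volume {x | x ∈ Metric.ball z ρ ∩ Ω ∧ k < w x}

/-- Energy inequalities on balls inside `Ω`; `k ≥ ess sup_{B_ρ} w - δM` is written as
`w ≤ k + δM` a.e. in `B_ρ`. -/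
def InteriorIneq {n : ℕ} (Ω : Set (E n)) (G : E n → ℝ → ℝ) (M γ γ₁ δ : ℝ) (w : E n → ℝ)
    (Dw : E n → E n) : Prop :=
  ∀ (z : E n) (ρ : ℝ), 0 < ρ → Metric.ball z ρ ⊆ Ω → ∀ σ : ℝ, 0 < σ → σ < 1 → ∀ k : ℝ,
    (∀ᵐ x ∂(volume.restrict (Metric.ball z ρ)), w x ≤ k + δ * M) →
      EnergyIneq Ω G γ γ₁ w Dw z ρ σ k

/-- Energy inequalities on balls meeting `∂Ω`, for
`k ≥ max {ess sup_{B_ρ ∩ Ω} w - δM, ess sup_{B_ρ ∩ ∂Ω} w}`; `τ` is the trace of `w`. -/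
def BoundaryIneq {n : ℕ} (Ω : Set (E n)) (G : E n → ℝ → ℝ) (M γ γ₁ δ : ℝ) (w : E n → ℝ)
    (Dw : E n → E n) (τ : E n → ℝ) : Prop :=
  ∀ (z : E n) (ρ : ℝ), 0 < ρ → (Metric.ball z ρ ∩ frontier Ω).Nonempty →
    ∀ σ : ℝ, 0 < σ → σ < 1 → ∀ k : ℝ,
      (∀ᵐ x ∂(volume.restrict (Metric.ball z ρ ∩ Ω)), w x ≤ k + δ * M) →
      (∀ᵐ x ∂((surf Ω).restrict (Metric.ball z ρ)), τ x ≤ k) →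
        EnergyIneq Ω G γ γ₁ w Dw z ρ σ k

/-- `u ∈ B_{G(x,t)}(Ω, M, γ, γ₁, δ)`. -/
structure InDG {n : ℕ} (Ω : Set (E n)) (G : E n → ℝ → ℝ) (M γ γ₁ δ : ℝ) (u : E n → ℝ)
    (Du : E n → E n) : Prop where
  M_pos : 0 < M
  γ_pos : 0 < γ
  γ₁_pos : 0 < γ₁
  δ_pos : 0 < δ
  δ_le : δ ≤ 2
  mem : MemW Ω G u Du
  bound : ∀ᵐ x ∂(volume.restrict Ω), |u x| ≤ M
  ineq_pos : InteriorIneq Ω G M γ γ₁ δ u Du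
  ineq_neg : InteriorIneq Ω G M γ γ₁ δ (fun x => -u x) (fun x => -Du x)

/-- `u ∈ B_{G(x,t)}(Ω̄, M, γ, γ₁, δ)`. -/
def InDGClosure {n : ℕ} (Ω : Set (E n)) (G : E n → ℝ → ℝ) (M γ γ₁ δ : ℝ) (u : E n → ℝ)
    (Du : E n → E n) : Prop :=
  InDG Ω G M γ γ₁ δ u Du ∧ ∃ τ : E n → ℝ, IsTrace Ω u τ ∧
    BoundaryIneq Ω G M γ γ₁ δ u Du τ ∧
    BoundaryIneq Ω G M γ γ₁ δ (fun x => -u x) (fun x => -Du x) (fun x => -τ x)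

/-! ### The Neumann problem -/

/-- The constants of the structure conditions, all positive. -/
structure Coeffs where
  (a₁ a₂ a₃ a₄ a₅ a₆ b₁ b₂ b₃ c₁ c₂ : ℝ)
  a₁_pos : 0 < a₁
  a₂_pos : 0 < a₂
  a₃_pos : 0 < a₃
  a₄_pos : 0 < a₄
  a₅_pos : 0 < a₅
  a₆_pos : 0 < a₆
  b₁_pos : 0 < b₁
  b₂_pos : 0 < b₂
  b₃_pos : 0 < b₃
  c₁_pos : 0 < c₁
  c₂_pos : 0 < c₂

/-- Carathéodory function of `(x, p)`: measurable in `x`, continuous in `p`. -/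
def Caratheodory {X Y Z : Type*} [MeasurableSpace X] [TopologicalSpace Y] [TopologicalSpace Z]
    [MeasurableSpace Z] (μ : Measure X) (f : X → Y → Z) : Prop :=
  (∀ p, AEMeasurable (fun x => f x p) μ) ∧ ∀ᵐ x ∂μ, Continuous (f x)

/-- `M(x,t) = H̃₁⁻¹(x, G(x,t))`. -/
def auxM {n : ℕ} (G H₁ : E n → ℝ → ℝ) (x : E n) (t : ℝ) : ℝ := inv (compl H₁ x) (G x t)

/-- `P(x,t) = G̃⁻¹(x, H₁(x,t))`. -/
def auxP {n : ℕ} (G H₁ : E n → ℝ → ℝ) (x : E n) (t : ℝ) : ℝ := inv (compl G x) (H₁ x t)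

/-- `A`, `B`, `C` are Carathéodory functions satisfying the `G(x,t)`-structure conditions. -/
structure StructureConds {n : ℕ} (Ω : Set (E n)) (G H₁ H₂ : E n → ℝ → ℝ) (K : Coeffs)
    (A : E n → ℝ → E n → E n) (B : E n → ℝ → E n → ℝ) (C : E n → ℝ → ℝ) : Prop where
  caraA : Caratheodory (volume.restrict Ω) (fun x (p : ℝ × E n) => A x p.1 p.2)
  caraB : Caratheodory (volume.restrict Ω) (fun x (p : ℝ × E n) => B x p.1 p.2)
  caraC : Caratheodory (surf Ω) C
  condA1 : ∀ᵐ x ∂(volume.restrict Ω), ∀ (s : ℝ) (η : E n),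
    K.a₄ * G x ‖η‖ - K.a₅ * H₁ x |s| - K.a₆ ≤ inner ℝ (A x s η) η
  condA2 : ∀ᵐ x ∂(volume.restrict Ω), ∀ (s : ℝ) (η : E n),
    ‖A x s η‖ ≤ K.a₁ * dens G x ‖η‖ + K.a₂ * auxP G H₁ x |s| + K.a₃
  condB : ∀ᵐ x ∂(volume.restrict Ω), ∀ (s : ℝ) (η : E n),
    |B x s η| ≤ K.b₁ * auxM G H₁ x ‖η‖ + K.b₂ * dens H₁ x |s| + K.b₃
  condC : ∀ᵐ x ∂(surf Ω), ∀ s : ℝ, |C x s| ≤ K.c₁ * dens H₂ x |s| + K.c₂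

/-- `u ∈ W^{1,G(x,t)}(Ω)` is a weak solution of `div A(x,u,Du) + B(x,u,Du) = 0` in `Ω`,
`A(x,u,Du) · ν = C(x,u)` on `∂Ω`. -/
def IsWeakSolution {n : ℕ} (Ω : Set (E n)) (G : E n → ℝ → ℝ) (A : E n → ℝ → E n → E n)
    (B : E n → ℝ → E n → ℝ) (C : E n → ℝ → ℝ) (u : E n → ℝ) (Du : E n → E n) : Prop :=
  MemW Ω G u Du ∧ ∃ τ : E n → ℝ, IsTrace Ω u τ ∧
    ∀ (v : E n → ℝ) (Dv : E n → E n) (τv : E n → ℝ), MemW Ω G v Dv → IsTrace Ω v τv →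
      (∫ x in Ω, inner ℝ (A x (u x) (Du x)) (Dv x)) - (∫ x, C x (τ x) * τv x ∂(surf Ω)) -
        (∫ x in Ω, B x (u x) (Du x) * v x) = 0

end DGNeumann

end

/-! The proof is a Caccioppoli estimate. For w = u or w = -u the equation is tested with v = φ^q (w
- k)⁺, where φ is a cutoff between the balls of radii ρ - σρ and ρ, and q = ⌈g⁺⌉. The level k
dominates the trace on the part of ∂Ω inside the ball and φ vanishes outside the ball, so v has
trace zero (`isTrace_zero`) and the boundary integral disappears. For a ball inside Ω the condition
on the trace is vacuous, so a single estimate, `EnergySetting.energyIneq`, serves interior and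
boundary balls.

What remains is ∫ (A·Dv - Bv) = 0 over A_{k,ρ}, and its integrand is estimated pointwise in
`pointwise_energy`. Coercivity yields a₄ φ^q G(x,|Dw|). The term with Dφ carries only φ^(q-1); with
s = (w - k)/(σρ), `PowerGrowth.density_mul_pow_mul_le` splits g(x,|Dw|) φ^(q-1) s into a small
multiple of φ^q G(x,|Dw|) and a multiple of G(x,s), which requires q ≥ g⁺. The functions P and M are
inverses of complementary functions, so their products obey Young's inequality (`inv_compl_mul_le`).
Since |w| ≤ M and w - k ≤ δM ≤ 2M on the ball, the values of H₁ that arise are bounded by constants.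
A and B each consume at most a₄/4 of the coercive term, and half of it survives.

The dependence of the constants is delicate in the term a₃ s: γ may not see F and γ₁ may not see g⁻.
`PowerGrowth.le_mul_add_exp` separates the two. The dimension does not enter because the cutoffs
come from one fixed function of one variable.

Admissibility of v rests on truncation and the product rule for weak gradients, obtained by
mollification, and on the doubling bounds that g⁺ provides. -/

/-! ### Pointwise properties of N-functions -/

namespace DGNeumann

/-- Pointwise properties of `Φ = G(x, ·)` for a generalized N-function whose density `g` satisfies
`m ≤ t g(t) / G(t) ≤ p`. -/
structure PowerGrowth (Φ : ℝ → ℝ) (m p : ℝ) : Prop where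
  convex : ConvexOn ℝ univ Φ
  even : ∀ t, Φ (-t) = Φ t
  zero : Φ 0 = 0
  pos : ∀ t, 0 < t → 0 < Φ t
  lim_zero : Tendsto (fun t => Φ t / t) (𝓝[≠] 0) (𝓝 0)
  lim_infty : Tendsto (fun t => Φ t / t) atTop atTop
  lower : ∀ t, 0 < t → m ≤ derivWithin Φ (Ici t) t * t / Φ t
  upper : ∀ t, 0 < t → derivWithin Φ (Ici t) t * t / Φ t ≤ p

namespace PowerGrowth

variable {Φ : ℝ → ℝ} {m p : ℝ}

lemma hasDeriv (h : PowerGrowth Φ m p) (t : ℝ) :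
    HasDerivWithinAt Φ (derivWithin Φ (Ici t) t) (Ici t) t := by
  rw [← derivWithin_Ioi_eq_Ici, ← hasDerivWithinAt_Ioi_iff_Ici]
  exact h.convex.hasDerivWithinAt_rightDeriv_of_mem_interior (by simp)

lemma continuous (h : PowerGrowth Φ m p) : Continuous Φ :=
  continuousOn_univ.1 (h.convex.continuousOn isOpen_univ)

lemma density_mono (h : PowerGrowth Φ m p) : Monotone fun t => derivWithin Φ (Ici t) t := by
  intro s t hst
  have := h.convex.monotoneOn_rightDeriv (a := s) (b := t) (by simp) (by simp) hst
  simpa [derivWithin_Ioi_eq_Ici] using this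

lemma density_zero (h : PowerGrowth Φ m p) : derivWithin Φ (Ici 0) 0 = 0 := by
  have h1 : HasDerivAt Φ 0 0 := by
    rw [hasDerivAt_iff_tendsto_slope]
    refine h.lim_zero.congr fun t => ?_
    simp [slope_def_field, h.zero]
  exact h1.hasDerivWithinAt.derivWithin (uniqueDiffWithinAt_Ici 0)

lemma density_nonneg (h : PowerGrowth Φ m p) {t : ℝ} (ht : 0 ≤ t) :
    0 ≤ derivWithin Φ (Ici t) t := by
  have := h.density_mono ht
  simpa [h.density_zero] using this

lemma nonneg (h : PowerGrowth Φ m p) {t : ℝ} (ht : 0 ≤ t) : 0 ≤ Φ t := by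
  rcases ht.eq_or_lt with rfl | ht
  · exact h.zero.ge
  · exact (h.pos t ht).le

lemma density_mul_le (h : PowerGrowth Φ m p) {t : ℝ} (ht : 0 ≤ t) :
    derivWithin Φ (Ici t) t * t ≤ p * Φ t := by
  rcases ht.eq_or_lt with rfl | ht
  · simp [h.zero]
  · exact (div_le_iff₀ (h.pos t ht)).1 (h.upper t ht)

lemma le_density_mul (h : PowerGrowth Φ m p) {t : ℝ} (ht : 0 < t) :
    m * Φ t ≤ derivWithin Φ (Ici t) t * t :=
  (le_div_iff₀ (h.pos t ht)).1 (h.lower t ht)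

lemma abs_eq (h : PowerGrowth Φ m p) (t : ℝ) : Φ |t| = Φ t := by
  rcases abs_cases t with ⟨h1, _⟩ | ⟨h1, _⟩ <;> simp [h1, h.even]

lemma mono (h : PowerGrowth Φ m p) : MonotoneOn Φ (Ici 0) := by
  intro s hs t ht hst
  rcases hst.eq_or_lt with rfl | hst
  · rfl
  have h1 := h.convex.rightDeriv_le_slope_of_mem_interior (x := s) (y := t) (by simp) (by simp) hst
  rw [derivWithin_Ioi_eq_Ici, slope_def_field, le_div_iff₀ (by linarith)] at h1
  have h2 := mul_nonneg (h.density_nonneg hs) (sub_nonneg.2 hst.le)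
  linarith

/-- The sign of this derivative is that of t g(t) - r Φ(t). Hence Φ(s) s^(-p) decreases and Φ(s)
s^(-m) increases, which gives the two power bounds below. Only right derivatives are available,
since a convex function may have corners. -/
lemma hasDeriv_mul_rpow (h : PowerGrowth Φ m p) (r : ℝ) {t : ℝ} (ht : 0 < t) :
    HasDerivWithinAt (fun s => Φ s * s ^ (-r))
      (t ^ (-r - 1) * (derivWithin Φ (Ici t) t * t - r * Φ t)) (Ici t) t := by
  have h1 := (h.hasDeriv t).mul
    ((Real.hasDerivAt_rpow_const (p := -r) (Or.inl ht.ne')).hasDerivWithinAt (s := Ici t))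
  refine h1.congr_deriv ?_
  have : t ^ (-r) = t ^ (-r - 1) * t := by
    rw [← Real.rpow_add_one ht.ne']; ring_nf
  rw [this]; ring

lemma scale_le (h : PowerGrowth Φ m p) {l t : ℝ} (hl : 1 ≤ l) (ht : 0 ≤ t) :
    Φ (l * t) ≤ l ^ p * Φ t := by
  rcases ht.eq_or_lt with rfl | ht
  · simp [h.zero]
  have hlt : t ≤ l * t := le_mul_of_one_le_left ht.le hl
  have key := image_le_of_deriv_right_le_deriv_boundary (a := t) (b := l * t)
    (f := fun s => Φ s * s ^ (-p)) (B := fun _ => Φ t * t ^ (-p)) (B' := fun _ => 0)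
    (f' := fun s => s ^ (-p - 1) * (derivWithin Φ (Ici s) s * s - p * Φ s))
    (h.continuous.continuousOn.mul (continuousOn_id.rpow_const
      fun s hs => Or.inl (ht.trans_le hs.1).ne'))
    (fun s hs => h.hasDeriv_mul_rpow p (ht.trans_le hs.1)) le_rfl continuousOn_const
    (fun s _ => hasDerivWithinAt_const _ _ _)
    (fun s hs => mul_nonpos_of_nonneg_of_nonpos
      (Real.rpow_nonneg (ht.le.trans hs.1) _)
      (sub_nonpos.2 (h.density_mul_le (ht.le.trans hs.1))))
    (right_mem_Icc.2 hlt)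
  have hl0 : 0 < l := by linarith
  simp only [Real.mul_rpow hl0.le ht.le, ← mul_assoc] at key
  have h3 := le_of_mul_le_mul_right key (Real.rpow_pos_of_pos ht _)
  rw [Real.rpow_neg hl0.le, ← div_eq_mul_inv, div_le_iff₀ (Real.rpow_pos_of_pos hl0 _)] at h3
  linarith

lemma rpow_mul_le (h : PowerGrowth Φ m p) {t : ℝ} (ht : 1 ≤ t) : t ^ m * Φ 1 ≤ Φ t := by
  have key := image_le_of_deriv_right_le_deriv_boundary (a := 1) (b := t)
    (f := fun _ => Φ 1) (B := fun s => Φ s * s ^ (-m)) (f' := fun _ => 0)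
    (B' := fun s => s ^ (-m - 1) * (derivWithin Φ (Ici s) s * s - m * Φ s))
    continuousOn_const (fun s _ => hasDerivWithinAt_const _ _ _) (by simp)
    (h.continuous.continuousOn.mul (continuousOn_id.rpow_const
      fun s hs => Or.inl (one_pos.trans_le hs.1).ne'))
    (fun s hs => h.hasDeriv_mul_rpow m (one_pos.trans_le hs.1))
    (fun s hs => mul_nonneg
      (Real.rpow_nonneg (zero_le_one.trans hs.1) _)
      (sub_nonneg.2 (h.le_density_mul (one_pos.trans_le hs.1))))
    (right_mem_Icc.2 ht)
  have ht0 : 0 < t := by linarith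
  simp only [Real.rpow_neg ht0.le] at key
  rw [← div_eq_mul_inv, le_div_iff₀ (Real.rpow_pos_of_pos ht0 _)] at key
  linarith

/-- The base 1 + t, rather than t, covers t < 1 without a case distinction. -/
lemma le_one_add_rpow (h : PowerGrowth Φ m p) {t : ℝ} (ht : 0 ≤ t) :
    Φ t ≤ (1 + t) ^ p * Φ 1 := by
  have h1 := h.scale_le (l := 1 + t) (t := 1) (by linarith) zero_le_one
  refine le_trans (h.mono ht (by simp; linarith) ?_) h1
  linarith

lemma add_le (h : PowerGrowth Φ m p) {s t : ℝ} (hs : 0 ≤ s) (ht : 0 ≤ t) :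
    Φ (s + t) ≤ 2 ^ p * (Φ s + Φ t) := by
  have h2 : (0 : ℝ) ≤ 2 ^ p := by positivity
  rcases le_total s t with hst | hst
  · have := h.mono (a := s + t) (b := 2 * t) (by simp; linarith) (by simp; linarith) (by linarith)
    have h3 := h.scale_le one_le_two ht
    nlinarith [h.nonneg hs]
  · have := h.mono (a := s + t) (b := 2 * s) (by simp; linarith) (by simp; linarith) (by linarith)
    have h3 := h.scale_le one_le_two hs
    nlinarith [h.nonneg ht]

/-- Young's inequality for the product of the density with a cutoff power. -/
lemma density_mul_pow_mul_le (h : PowerGrowth Φ m p) (hp : 0 ≤ p) {q : ℕ} (hq : 2 ≤ q)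
    (hpq : p ≤ q) {κ c s t : ℝ} (hκ : 0 < κ) (hκ1 : κ ≤ 1) (hc : 0 ≤ c) (hc1 : c ≤ 1)
    (hs : 0 ≤ s) (ht : 0 ≤ t) :
    derivWithin Φ (Ici t) t * c ^ (q - 1) * s ≤
      p * κ * (c ^ q * Φ t) + p * κ * κ⁻¹ ^ p * Φ s := by
  have hg := h.density_nonneg ht
  have hcq : c ^ q = c ^ (q - 1) * c := by rw [← pow_succ]; congr; omega
  have e1 : 0 ≤ p * κ * (c ^ q * Φ t) := by have := h.nonneg ht; positivity
  have e2 : 0 ≤ p * κ * κ⁻¹ ^ p * Φ s := by have := h.nonneg hs; positivity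
  -- If s ≤ κct, then t g(t) ≤ p Φ(t) suffices. Otherwise t < r = s/(κc); monotonicity moves the
  -- density to r, and the factor c^(-p) lost by scaling Φ(r) back to Φ(s) is compensated by c^q
  -- because p ≤ q.
  rcases le_or_gt s (κ * c * t) with hst | hst
  · have h1 : derivWithin Φ (Ici t) t * c ^ (q - 1) * s ≤
        derivWithin Φ (Ici t) t * c ^ (q - 1) * (κ * c * t) :=
      mul_le_mul_of_nonneg_left hst (by positivity)
    have h2 : derivWithin Φ (Ici t) t * c ^ (q - 1) * (κ * c * t) ≤ p * κ * (c ^ q * Φ t) := by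
      rw [hcq]
      have := mul_le_mul_of_nonneg_left (h.density_mul_le ht)
        (show 0 ≤ κ * (c ^ (q - 1) * c) by positivity)
      linarith
    linarith
  · have hs0 : 0 < s := lt_of_le_of_lt (by positivity) hst
    rcases hc.eq_or_lt with rfl | hc0
    · have : q - 1 ≠ 0 := by omega
      simp only [zero_pow this, mul_zero, zero_mul]
      linarith
    · have hkc : 0 < κ * c := by positivity
      have hkc1 : κ * c ≤ 1 := by nlinarith
      set r := (κ * c)⁻¹ * s with hr
      have hr0 : 0 < r := by positivity
      have htr : t ≤ r := by
        rw [hr, inv_mul_eq_div, le_div_iff₀ hkc]; linarith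
      have h1 : derivWithin Φ (Ici t) t ≤ derivWithin Φ (Ici r) r := h.density_mono htr
      have h2 := h.density_mul_le hr0.le
      have h3 : Φ r ≤ (κ * c)⁻¹ ^ p * Φ s := h.scale_le ((one_le_inv₀ hkc).2 hkc1) hs
      have hsr : s = κ * c * r := by rw [hr]; field_simp
      have h4 : c ^ q * (κ * c)⁻¹ ^ p ≤ κ⁻¹ ^ p := by
        rw [mul_inv, Real.mul_rpow (by positivity) (by positivity), Real.inv_rpow hc, mul_left_comm]
        refine mul_le_of_le_one_right (by positivity) ?_
        rw [← div_eq_mul_inv, div_le_one (by positivity), ← Real.rpow_natCast]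
        exact Real.rpow_le_rpow_of_exponent_ge hc0 hc1 hpq
      calc derivWithin Φ (Ici t) t * c ^ (q - 1) * s
          ≤ derivWithin Φ (Ici r) r * c ^ (q - 1) * s := by gcongr
        _ = derivWithin Φ (Ici r) r * c ^ (q - 1) * (κ * c * r) := by rw [← hsr]
        _ = κ * c ^ q * (derivWithin Φ (Ici r) r * r) := by rw [hcq]; ring
        _ ≤ κ * c ^ q * (p * ((κ * c)⁻¹ ^ p * Φ s)) := by
            exact mul_le_mul_of_nonneg_left (h2.trans (by gcongr)) (by positivity)
        _ = p * κ * (c ^ q * (κ * c)⁻¹ ^ p) * Φ s := by ring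
        _ ≤ p * κ * κ⁻¹ ^ p * Φ s := by have := h.nonneg hs; gcongr
        _ ≤ _ := by linarith

/-- `a s ≤ γ Φ(s) + γ₁` where `γ` does not depend on `Φ(1)` and `γ₁` does not depend on `m`. -/
lemma le_mul_add_exp (h : PowerGrowth Φ m p) (hm : 1 < m) {F : ℝ} (hF : 1 ≤ F) (hF1 : F⁻¹ ≤ Φ 1)
    {s : ℝ} (hs : 0 ≤ s) : s ≤ (1 + (m - 1)⁻¹) * Φ s + Real.exp F := by
  have hm0 : 0 < m - 1 := by linarith
  have e1 : 0 ≤ (1 + (m - 1)⁻¹) * Φ s := mul_nonneg (by positivity) (h.nonneg hs)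
  -- Beyond the threshold e^F one has log s ≥ F, hence s^(m-1) ≥ (m-1) F. This absorbs the factor F
  -- from Φ(1) ≥ 1/F, so F stays out of the coefficient and m out of the threshold.
  rcases le_or_gt s (Real.exp F) with h1 | h1
  · linarith
  have hs1 : 1 ≤ s := le_trans (Real.one_le_exp (by linarith)) h1.le
  have hs0 : 0 < s := by linarith
  have h2 := h.rpow_mul_le hs1
  have h3 : s ^ m = s ^ (m - 1) * s := by rw [← Real.rpow_add_one hs0.ne']; ring_nf
  have hlog : F ≤ Real.log s := (Real.le_log_iff_exp_le hs0).2 h1.le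
  have h4 : (m - 1) * F ≤ s ^ (m - 1) := by
    rw [Real.rpow_def_of_pos hs0]
    have := Real.add_one_le_exp (Real.log s * (m - 1))
    nlinarith
  have h5 : F ≤ (1 + (m - 1)⁻¹) * s ^ (m - 1) := by
    have : F ≤ (m - 1)⁻¹ * s ^ (m - 1) := by
      rw [inv_mul_eq_div, le_div_iff₀ hm0]; linarith
    have : 0 ≤ s ^ (m - 1) := by positivity
    linarith
  have hF0 : 0 < F := by linarith
  have h6 : s ≤ (1 + (m - 1)⁻¹) * Φ s := by
    calc s = F * s * F⁻¹ := by field_simp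
      _ ≤ (1 + (m - 1)⁻¹) * s ^ (m - 1) * s * Φ 1 := by gcongr
      _ = (1 + (m - 1)⁻¹) * (s ^ m * Φ 1) := by rw [h3]; ring
      _ ≤ _ := by gcongr
  linarith [Real.exp_pos F]

/-- Superlinear growth makes t s - Φ(s) nonpositive for large s. Boundedness is needed because the
real `sSup` of an unbounded set is 0 by default. -/
lemma bddAbove_compl (h : PowerGrowth Φ m p) (t : ℝ) :
    BddAbove ((fun s => t * s - Φ s) '' Ici 0) := by
  obtain ⟨R, hR⟩ := (h.lim_infty.eventually_ge_atTop t).exists_forall_of_atTop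
  refine ⟨|t| * |R| , ?_⟩
  rintro _ ⟨s, hs, rfl⟩
  have hs : 0 ≤ s := hs
  have h0 := h.nonneg hs
  rcases le_total s |R| with hsR | hsR
  · have h1 : t * s ≤ |t| * |R| := mul_le_mul (le_abs_self t) hsR hs (abs_nonneg _)
    simp only; linarith
  · rcases hs.eq_or_lt with rfl | hs0
    · simp [h.zero]; positivity
    have h1 := (le_div_iff₀ hs0).1 (hR s ((le_abs_self R).trans hsR))
    have : 0 ≤ |t| * |R| := by positivity
    simp only; linarith

end PowerGrowth

/-- Young's inequality for the inverse of the complementary function. -/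
lemma inv_compl_mul_le {n : ℕ} {H : E n → ℝ → ℝ} {x : E n} {m p : ℝ} (h : PowerGrowth (H x) m p)
    {y r : ℝ} (hy : 0 ≤ y) (hr : 0 ≤ r) : inv (compl H x) y * r ≤ y + H x r := by
  have h0 : 0 ≤ y + H x r := add_nonneg hy (h.nonneg hr)
  rcases hr.eq_or_lt with rfl | hr0
  · simpa using h0
  rw [← le_div_iff₀ hr0]
  -- It suffices to bound each s whose complementary value is at most y; the nonnegativity of the
  -- bound covers an empty set.
  refine Real.sSup_le ?_ (by positivity)
  rintro s ⟨_, hs⟩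
  rw [le_div_iff₀ hr0]
  have : s * r - H x r ≤ compl H x s := le_csSup (h.bddAbove_compl s) ⟨r, hr, rfl⟩
  linarith

lemma inv_nonneg (f : ℝ → ℝ) (t : ℝ) : 0 ≤ inv f t :=
  Real.sSup_nonneg fun _ hs => hs.1

end DGNeumann

/-! ### Mollification -/

namespace DGNeumann

variable {n : ℕ}

/-- A bump function at `0` with outer radius `1 / (j + 1)`. -/
noncomputable def bump (n j : ℕ) : ContDiffBump (0 : E n) where
  rIn := 1 / (j + 1) / 2
  rOut := 1 / (j + 1)
  rIn_pos := by positivity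
  rIn_lt_rOut := half_lt_self (by positivity)

/-- The standard mollification of `f` at scale `1 / (j + 1)`. -/
noncomputable def mollify (j : ℕ) (f : E n → ℝ) : E n → ℝ :=
  MeasureTheory.convolution ((bump n j).normed volume) f (ContinuousLinearMap.lsmul ℝ ℝ) volume

lemma mollify_apply (j : ℕ) (f : E n → ℝ) (x : E n) :
    mollify j f x = ∫ t, (bump n j).normed volume (x - t) * f t := by
  simp [mollify, convolution_lsmul_swap]

lemma tendsto_bump_rOut (n : ℕ) : Tendsto (fun j => (bump n j).rOut) atTop (𝓝 0) :=
  tendsto_one_div_add_atTop_nhds_zero_nat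

lemma ae_tendsto_mollify {f : E n → ℝ} (hf : Integrable f) :
    ∀ᵐ x, Tendsto (fun j => mollify j f x) atTop (𝓝 (f x)) :=
  -- The ratio of outer to inner radius is exactly 2, so the kernels are comparable to averages over
  -- balls.
  ContDiffBump.ae_convolution_tendsto_right_of_locallyIntegrable (K := 2)
    (tendsto_bump_rOut n)
    (Eventually.of_forall fun j => by simp only [bump]; linarith) hf.locallyIntegrable

lemma integrable_mollify (j : ℕ) {f : E n → ℝ} (hf : Integrable f) : Integrable (mollify j f) :=
  (bump n j).integrable_normed.integrable_convolution _ hf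

lemma integral_mollify (j : ℕ) {f : E n → ℝ} (hf : Integrable f) :
    ∫ x, mollify j f x = ∫ x, f x := by
  unfold mollify
  rw [integral_convolution _ (bump n j).integrable_normed hf, (bump n j).integral_normed]
  simp

lemma mollify_nonneg (j : ℕ) {f : E n → ℝ} (hf : ∀ x, 0 ≤ f x) (x : E n) : 0 ≤ mollify j f x := by
  rw [mollify_apply]
  exact integral_nonneg fun t => mul_nonneg ((bump n j).nonneg_normed _) (hf t)

lemma integrable_mollify_integrand (j : ℕ) {f : E n → ℝ} (hf : Integrable f) (x : E n) :
    Integrable fun t => (bump n j).normed volume (x - t) * f t := by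
  have hc : Continuous fun t => (bump n j).normed volume (x - t) :=
    ((bump n j).continuous_normed (μ := volume)).comp (continuous_const.sub continuous_id)
  refine hf.bdd_mul (c := 1 / volume.real (Metric.closedBall (0 : E n) (bump n j).rIn))
    hc.aestronglyMeasurable (Eventually.of_forall fun t => ?_)
  rw [Real.norm_of_nonneg ((bump n j).nonneg_normed (μ := volume) _)]
  exact (bump n j).normed_le_div_measure_closedBall_rIn (μ := volume) _

lemma mollify_sub (j : ℕ) {f g : E n → ℝ} (hf : Integrable f) (hg : Integrable g) (x : E n) :
    mollify j (fun y => f y - g y) x = mollify j f x - mollify j g x := by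
  simp only [mollify_apply, mul_sub]
  exact integral_sub (integrable_mollify_integrand j hf x) (integrable_mollify_integrand j hg x)

/-- Scheffé's argument: mollification preserves the integral, so the L¹ distance is twice the
integral of (f - f_j)⁺. For f ≥ 0 that function is dominated by f and tends to 0 almost everywhere.
-/
lemma tendsto_integral_abs_mollify_sub_of_nonneg {f : E n → ℝ} (hf : Integrable f)
    (h0 : ∀ x, 0 ≤ f x) : Tendsto (fun j => ∫ x, |mollify j f x - f x|) atTop (𝓝 0) := by
  have key : ∀ j, ∫ x, |mollify j f x - f x| = 2 * ∫ x, max (f x - mollify j f x) 0 := by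
    intro j
    have hm := integrable_mollify j hf
    have hp : Integrable fun x => max (f x - mollify j f x) 0 := (hf.sub hm).pos_part
    have : ∀ x, |mollify j f x - f x| =
        (mollify j f x - f x) + 2 * max (f x - mollify j f x) 0 := by
      intro x
      rcases le_total (f x) (mollify j f x) with h | h
      · rw [abs_of_nonneg (by linarith), max_eq_right (by linarith)]; ring
      · rw [abs_of_nonpos (by linarith), max_eq_left (by linarith)]; ring
    simp only [this]
    have hd : Integrable fun x => mollify j f x - f x := hm.sub hf
    rw [integral_add hd (hp.const_mul 2), integral_sub hm hf, integral_mollify j hf,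
      integral_const_mul]
    ring
  simp only [key]
  have hlim : Tendsto (fun j => ∫ x, max (f x - mollify j f x) 0) atTop
      (𝓝 (∫ _ : E n, (0 : ℝ))) := by
    refine (tendsto_integral_of_dominated_convergence f
    (fun j => ((hf.sub (integrable_mollify j hf)).pos_part).aestronglyMeasurable) hf
    (fun j => Eventually.of_forall fun x => ?_) ?_)
    · have := mollify_nonneg j h0 x
      rw [Real.norm_of_nonneg (le_max_right _ _)]
      exact max_le (by linarith) (h0 x)
    · filter_upwards [ae_tendsto_mollify hf] with x hx
      have : Tendsto (fun j => max (f x - mollify j f x) 0) atTop (𝓝 (max (f x - f x) 0)) :=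
        (tendsto_const_nhds.sub hx).max tendsto_const_nhds
      simpa using this
  simpa using hlim.const_mul 2

lemma tendsto_integral_abs_mollify_sub {f : E n → ℝ} (hf : Integrable f) :
    Tendsto (fun j => ∫ x, |mollify j f x - f x|) atTop (𝓝 0) := by
  have hp : Integrable fun x => max (f x) 0 := hf.pos_part
  have hn : Integrable fun x => max (-f x) 0 := hf.neg_part
  have hfe : f = fun x => max (f x) 0 - max (-f x) 0 := by
    ext x
    rcases le_total (f x) 0 with h | h
    · rw [max_eq_right h, max_eq_left (by linarith)]; ring
    · rw [max_eq_left h, max_eq_right (by linarith)]; ring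
  have h1 := (tendsto_integral_abs_mollify_sub_of_nonneg hp fun x => le_max_right _ _).add
    (tendsto_integral_abs_mollify_sub_of_nonneg hn fun x => le_max_right _ _)
  rw [add_zero] at h1
  refine squeeze_zero (fun j => integral_nonneg fun x => abs_nonneg _) (fun j => ?_) h1
  have i1 := ((integrable_mollify j hp).sub hp).abs
  have i2 := ((integrable_mollify j hn).sub hn).abs
  refine le_trans (integral_mono ((integrable_mollify j hf).sub hf).abs (i1.add i2) fun x => ?_)
    (integral_add i1 i2).le
  have e1 : mollify j f x = _ := congrArg (fun g => mollify j g x) hfe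
  rw [mollify_sub j hp hn] at e1
  have e2 : f x = _ := congrFun hfe x
  simp only [Pi.add_apply, Pi.sub_apply]
  rw [e1]
  conv_lhs => rw [e2]
  rw [sub_sub_sub_comm]
  exact abs_sub _ _

lemma contDiff_mollify (j : ℕ) {f : E n → ℝ} (hf : Integrable f) : ContDiff ℝ 1 (mollify j f) :=
  (bump n j).hasCompactSupport_normed.contDiff_convolution_left (n := 1) _
    (bump n j).contDiff_normed hf.locallyIntegrable

lemma fderiv_mollify (j : ℕ) {f : E n → ℝ} (hf : Integrable f) (x e : E n) :
    fderiv ℝ (mollify j f) x e = ∫ t, fderiv ℝ ((bump n j).normed volume) (x - t) e * f t := by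
  have hc : HasCompactSupport ((bump n j).normed (volume : Measure (E n))) :=
    (bump n j).hasCompactSupport_normed
  have hs : ContDiff ℝ 1 ((bump n j).normed (volume : Measure (E n))) :=
    (bump n j).contDiff_normed (n := 1)
  have h := (hc.hasFDerivAt_convolution_left (ContinuousLinearMap.lsmul ℝ ℝ) hs
    hf.locallyIntegrable x).fderiv
  have hex := (hc.fderiv ℝ).convolutionExists_left
    (μ := volume) ((ContinuousLinearMap.lsmul ℝ ℝ : ℝ →L[ℝ] ℝ →L[ℝ] ℝ).precompL (E n))
    (hs.continuous_fderiv one_ne_zero) hf.locallyIntegrable x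
  unfold mollify
  rw [h, convolution_eq_swap, ContinuousLinearMap.integral_apply hex.integrable_swap]
  simp [ContinuousLinearMap.precompL_apply]

namespace IsWeakGradient

variable {Ω : Set (E n)} {u : E n → ℝ} {Du : E n → E n}

/-- The kernel t ↦ η(x - t) is supported in K ⊆ Ω and is therefore an admissible test function. The
sign from differentiating in t rather than x cancels the sign in the definition of the weak
gradient. -/
lemma fderiv_mollify_indicator (h : IsWeakGradient Ω u Du) {K : Set (E n)} (hK : IsCompact K)
    (hKΩ : K ⊆ Ω) {j : ℕ} {x : E n} (hx : Metric.closedBall x (bump n j).rOut ⊆ K) (e : E n) :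
    fderiv ℝ (mollify j (K.indicator u)) x e =
      mollify j (K.indicator fun y => inner ℝ (Du y) e) x := by
  set η := (bump n j).normed (volume : Measure (E n)) with hη
  have hu : Integrable (K.indicator u) :=
    (h.locInt.integrableOn_compact_subset hKΩ hK).integrable_indicator hK.measurableSet
  have hs : ContDiff ℝ (⊤ : ℕ∞) η := (bump n j).contDiff_normed
  have hψ : ContDiff ℝ (⊤ : ℕ∞) fun t => η (x - t) := hs.comp (contDiff_const.sub contDiff_id)
  have hsupp : ∀ t, t ∉ Metric.closedBall x (bump n j).rOut → η (x - t) = 0 := by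
    intro t ht
    rw [← Function.notMem_support, hη, (bump n j).support_normed_eq]
    intro hmem
    rw [mem_ball_zero_iff, ← dist_eq_norm, dist_comm] at hmem
    exact ht (Metric.mem_closedBall.2 hmem.le)
  have hts : tsupport (fun t => η (x - t)) ⊆ Metric.closedBall x (bump n j).rOut :=
    closure_minimal (fun t ht => by_contra fun h => ht (hsupp t h)) Metric.isClosed_closedBall
  have hdψ : ∀ t, fderiv ℝ (fun t => η (x - t)) t e = -fderiv ℝ η (x - t) e := by
    intro t
    have h1 : HasFDerivAt (fun t => x - t) (-ContinuousLinearMap.id ℝ (E n)) t := by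
      simpa using (hasFDerivAt_id t).const_sub x
    have h2 := ((hs.differentiable (by simp)) (x - t)).hasFDerivAt.comp t h1
    have h3 : fderiv ℝ (fun t => η (x - t)) t = _ := h2.fderiv
    rw [h3]; simp
  have hparts := h.parts _ hψ ((isCompact_closedBall x _).of_isClosed_subset
    (isClosed_tsupport _) hts) (hts.trans (hx.trans hKΩ)) e
  have hdz : ∀ t, t ∉ K → fderiv ℝ η (x - t) e = 0 := by
    intro t ht
    have : fderiv ℝ (fun t => η (x - t)) t = 0 :=
      image_eq_zero_of_notMem_tsupport fun hmem => ht (hx (hts (tsupport_fderiv_subset ℝ hmem)))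
    rw [← neg_eq_zero, ← hdψ, this]; simp
  rw [fderiv_mollify j hu, mollify_apply]
  have e1 : ∫ t, fderiv ℝ η (x - t) e * K.indicator u t =
      -∫ t in Ω, u t * fderiv ℝ (fun t => η (x - t)) t e := by
    rw [← integral_neg, ← setIntegral_eq_integral_of_forall_compl_eq_zero (s := Ω)]
    · refine integral_congr_ae (Eventually.of_forall fun t => ?_)
      by_cases ht : t ∈ K
      · simp only [hdψ, indicator_of_mem ht]; ring
      · simp only [hdψ, indicator_of_notMem ht, hdz t ht]; simp
    · intro t ht
      rw [indicator_of_notMem fun hk => ht (hKΩ hk), mul_zero]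
  have e2 : ∫ t, η (x - t) * K.indicator (fun y => inner ℝ (Du y) e) t =
      ∫ t in Ω, inner ℝ (Du t) e * η (x - t) := by
    rw [← setIntegral_eq_integral_of_forall_compl_eq_zero (s := Ω)]
    · refine integral_congr_ae (Eventually.of_forall fun t => ?_)
      by_cases ht : t ∈ K
      · simp only [indicator_of_mem ht]; ring
      · simp only [indicator_of_notMem ht, hsupp t fun hk => ht (hx hk)]; simp
    · intro t ht
      rw [indicator_of_notMem fun hk => ht (hKΩ hk), mul_zero]
  rw [e1, e2, hparts, neg_neg]

end IsWeakGradient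

end DGNeumann

/-! ### Truncation and products of weakly differentiable functions -/

namespace DGNeumann

variable {n : ℕ}

lemma locallyIntegrableOn_of_le {X F : Type*} [NormedAddCommGroup X] [NormedAddCommGroup F]
    {Ω : Set (E n)} (hΩ : IsOpen Ω)
    {f : E n → X} {g : E n → F} (hf : LocallyIntegrableOn f Ω)
    (hg : AEStronglyMeasurable g (volume.restrict Ω))
    (hle : ∀ᵐ x ∂(volume.restrict Ω), ‖g x‖ ≤ ‖f x‖) : LocallyIntegrableOn g Ω := by
  rw [locallyIntegrableOn_iff hΩ.isLocallyClosed] at hf ⊢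
  intro K hK hKc
  have hle' : volume.restrict K ≤ volume.restrict Ω := Measure.restrict_mono hK le_rfl
  exact Integrable.mono (hf K hK hKc) (hg.mono_measure hle') (ae_mono hle' hle)

namespace IsWeakGradient

variable {Ω : Set (E n)} {u : E n → ℝ} {Du : E n → E n}

lemma integrable_indicator (h : IsWeakGradient Ω u Du) {K : Set (E n)} (hK : IsCompact K)
    (hKΩ : K ⊆ Ω) : Integrable (K.indicator u) :=
  (h.locInt.integrableOn_compact_subset hKΩ hK).integrable_indicator hK.measurableSet

lemma integrable_indicator_inner (h : IsWeakGradient Ω u Du) {K : Set (E n)} (hK : IsCompact K)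
    (hKΩ : K ⊆ Ω) (e : E n) : Integrable (K.indicator fun y => inner ℝ (Du y) e) := by
  have h1 : IntegrableOn Du K := h.locInt_grad.integrableOn_compact_subset hKΩ hK
  have h2 : IntegrableOn (fun y => inner ℝ (Du y) e) K := by
    refine Integrable.mono' (h1.norm.mul_const ‖e‖)
      (h1.aestronglyMeasurable.inner aestronglyMeasurable_const)
      (Eventually.of_forall fun y => norm_inner_le_norm _ _)
  exact h2.integrable_indicator hK.measurableSet

/-- Chain rule for a `C¹` function with bounded derivative. -/
lemma integral_comp_mul_fderiv (h : IsWeakGradient Ω u Du) (hΩ : IsOpen Ω) {F F' : ℝ → ℝ}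
    (hF : ∀ t, HasDerivAt F (F' t) t) (hFc : Continuous F') (hF1 : ∀ t, |F' t| ≤ 1)
    {φ : E n → ℝ} (hφ : ContDiff ℝ (⊤ : ℕ∞) φ) (hφc : HasCompactSupport φ) (hφΩ : tsupport φ ⊆ Ω)
    (e : E n) :
    ∫ x in Ω, F (u x) * fderiv ℝ φ x e = -∫ x in Ω, F' (u x) * inner ℝ (Du x) e * φ x := by
  -- The margin δ leaves room for the mollifier: once its radius is below δ, gradient and
  -- mollification commute at every point of the support of φ, and cutting u off outside K has no
  -- effect there.
  obtain ⟨δ, hδ, hδΩ⟩ := (show IsCompact (tsupport φ) from hφc).exists_cthickening_subset_open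
    hΩ hφΩ
  set K := Metric.cthickening δ (tsupport φ) with hK
  have hKc : IsCompact K := (show IsCompact (tsupport φ) from hφc).cthickening
  set f := K.indicator u with hf
  set g := K.indicator fun y => inner ℝ (Du y) e with hg
  have hfi : Integrable f := h.integrable_indicator hKc hδΩ
  have hgi : Integrable g := h.integrable_indicator_inner hKc hδΩ e
  have hφK : ∀ x, x ∉ K → φ x = 0 := fun x hx => image_eq_zero_of_notMem_tsupport fun hmem =>
    hx (Metric.self_subset_cthickening _ hmem)
  have hdφK : ∀ x, x ∉ K → fderiv ℝ φ x = 0 := fun x hx =>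
    image_eq_zero_of_notMem_tsupport fun hmem =>
      hx (Metric.self_subset_cthickening _ (tsupport_fderiv_subset ℝ hmem))
  have hdφc : Continuous fun x => fderiv ℝ φ x e :=
    (hφ.continuous_fderiv (by simp)).clm_apply continuous_const
  have hdφs : HasCompactSupport fun x => fderiv ℝ φ x e := hφc.fderiv_apply ℝ e
  obtain ⟨C₁, hC₁⟩ := hdφs.exists_bound_of_continuous hdφc
  obtain ⟨C₂, hC₂⟩ := hφc.exists_bound_of_continuous hφ.continuous
  have hFlip : ∀ s t, |F s - F t| ≤ |s - t| := by
    intro s t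
    have := Convex.norm_image_sub_le_of_norm_hasDerivWithin_le (f := F) (f' := F') (C := 1)
      (s := univ) (fun x _ => (hF x).hasDerivWithinAt) (fun x _ => hF1 x) convex_univ
      (mem_univ t) (mem_univ s)
    simpa using this
  have hFcont : Continuous F := continuous_iff_continuousAt.2 fun t => (hF t).continuousAt
  -- the approximating identity
  have happrox : ∀ᶠ j in atTop, ∫ x, F (mollify j f x) * fderiv ℝ φ x e =
      -∫ x, F' (mollify j f x) * mollify j g x * φ x := by
    filter_upwards [(tendsto_bump_rOut n).eventually (gt_mem_nhds hδ)] with j hj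
    have hm := contDiff_mollify j hfi
    have hd : ∀ x, HasFDerivAt (fun x => F (mollify j f x))
        (F' (mollify j f x) • fderiv ℝ (mollify j f) x) x := fun x =>
      (hF _).comp_hasFDerivAt x ((hm.differentiable one_ne_zero) x).hasFDerivAt
    have hdc : Continuous fun x => fderiv ℝ (fun x => F (mollify j f x)) x e := by
      have : (fun x => fderiv ℝ (fun x => F (mollify j f x)) x e) =
          fun x => F' (mollify j f x) * fderiv ℝ (mollify j f) x e := by
        ext x; rw [(hd x).fderiv]; simp
      rw [this]
      exact (hFc.comp hm.continuous).mul
        ((hm.continuous_fderiv one_ne_zero).clm_apply continuous_const)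
    have hFm : Continuous fun x => F (mollify j f x) := hFcont.comp hm.continuous
    rw [integral_mul_fderiv_eq_neg_fderiv_mul_of_integrable
      ((hdc.mul hφ.continuous).integrable_of_hasCompactSupport hφc.mul_left)
      ((hFm.mul hdφc).integrable_of_hasCompactSupport hdφs.mul_left)
      ((hFm.mul hφ.continuous).integrable_of_hasCompactSupport hφc.mul_left)
      (fun x _ => (hd x).differentiableAt) (fun x _ => hφ.differentiable (by simp) x)]
    congr 1
    refine integral_congr_ae (Eventually.of_forall fun x => ?_)
    by_cases hx : x ∈ tsupport φ
    · have hb : Metric.closedBall x (bump n j).rOut ⊆ K :=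
        (Metric.closedBall_subset_closedBall hj.le).trans
          (Metric.closedBall_subset_cthickening hx δ)
      simp only [(hd x).fderiv]
      rw [_root_.smul_apply, h.fderiv_mollify_indicator hKc hδΩ hb e, smul_eq_mul]
    · simp only [image_eq_zero_of_notMem_tsupport hx, mul_zero]
  have hmeas : ∀ j, AEStronglyMeasurable (mollify j f) volume := fun j =>
    (integrable_mollify j hfi).aestronglyMeasurable
  -- limit of the left-hand side
  have hFint : ∀ w : E n → ℝ, AEStronglyMeasurable w volume → Integrable w →
      Integrable fun x => F (w x) * fderiv ℝ φ x e := by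
    intro w hw hwi
    -- F(0) need not vanish, so F(w) itself need not be integrable over the whole space; the
    -- constant is treated separately.
    have i1 : Integrable fun x => (F (w x) - F 0) * fderiv ℝ φ x e := by
      have : Integrable fun x => F (w x) - F 0 := by
        refine hwi.mono ((hFcont.comp_aestronglyMeasurable hw).sub aestronglyMeasurable_const)
          (Eventually.of_forall fun x => ?_)
        simpa using hFlip (w x) 0
      exact this.mul_bdd (c := C₁) hdφc.aestronglyMeasurable (Eventually.of_forall hC₁)
    have i2 : Integrable fun x => F 0 * fderiv ℝ φ x e :=
      (hdφc.integrable_of_hasCompactSupport hdφs).const_mul _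
    refine (i1.add i2).congr (Eventually.of_forall fun x => ?_)
    simp only [Pi.add_apply]; ring
  have hL : Tendsto (fun j => ∫ x, F (mollify j f x) * fderiv ℝ φ x e) atTop
      (𝓝 (∫ x, F (f x) * fderiv ℝ φ x e)) := by
    rw [tendsto_iff_norm_sub_tendsto_zero]
    have h0 := (tendsto_integral_abs_mollify_sub hfi).mul_const C₁
    rw [zero_mul] at h0
    refine squeeze_zero (fun _ => norm_nonneg _) (fun j => ?_) h0
    rw [← integral_sub (hFint _ (hmeas j) (integrable_mollify j hfi))
      (hFint _ hfi.aestronglyMeasurable hfi), ← integral_mul_const]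
    refine norm_integral_le_of_norm_le
      (((integrable_mollify j hfi).sub hfi).abs.mul_const C₁) (Eventually.of_forall fun x => ?_)
    rw [← sub_mul, norm_mul]
    exact mul_le_mul (hFlip _ _) (hC₁ x) (norm_nonneg _) (abs_nonneg _)
  -- limit of the right-hand side
  have hFb : ∀ (w v : E n → ℝ), AEStronglyMeasurable w volume → Integrable v →
      Integrable fun x => F' (w x) * v x * φ x := by
    intro w v hw hv
    refine Integrable.mul_bdd (c := C₂) ?_ hφ.continuous.aestronglyMeasurable
      (Eventually.of_forall hC₂)
    exact hv.bdd_mul (c := 1) (hFc.comp_aestronglyMeasurable hw)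
      (Eventually.of_forall fun x => hF1 _)
  -- F' is only continuous and bounded. The product is split so that L¹ convergence handles the
  -- gradient factor with F' bounded, and dominated convergence handles F' with the gradient factor
  -- fixed.
  have hR1 : Tendsto (fun j => ∫ x, F' (mollify j f x) * (mollify j g x - g x) * φ x) atTop
      (𝓝 0) := by
    have h0 := (tendsto_integral_abs_mollify_sub hgi).mul_const C₂
    rw [zero_mul] at h0
    refine squeeze_zero_norm (fun j => ?_) h0
    rw [← integral_mul_const]
    refine norm_integral_le_of_norm_le
      (((integrable_mollify j hgi).sub hgi).abs.mul_const C₂) (Eventually.of_forall fun x => ?_)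
    rw [norm_mul, norm_mul]
    refine mul_le_mul ?_ (hC₂ x) (norm_nonneg _) (abs_nonneg _)
    exact mul_le_of_le_one_left (norm_nonneg _) (hF1 _)
  have hR2 : Tendsto (fun j => ∫ x, F' (mollify j f x) * g x * φ x) atTop
      (𝓝 (∫ x, F' (f x) * g x * φ x)) := by
    refine tendsto_integral_of_dominated_convergence (fun x => |g x| * C₂)
      (fun j => (hFb _ _ (hmeas j) hgi).aestronglyMeasurable) (hgi.abs.mul_const _)
      (fun j => Eventually.of_forall fun x => ?_) ?_
    · rw [norm_mul, norm_mul]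
      refine mul_le_mul ?_ (hC₂ x) (norm_nonneg _) (abs_nonneg _)
      exact mul_le_of_le_one_left (norm_nonneg _) (hF1 _)
    · filter_upwards [ae_tendsto_mollify hfi] with x hx
      exact (((hFc.tendsto _).comp hx).mul_const _).mul_const _
  have hR : Tendsto (fun j => ∫ x, F' (mollify j f x) * mollify j g x * φ x) atTop
      (𝓝 (∫ x, F' (f x) * g x * φ x)) := by
    have := hR1.add hR2
    rw [zero_add] at this
    refine this.congr fun j => ?_
    have i1 : Integrable fun x => F' (mollify j f x) * (mollify j g x - g x) * φ x :=
      hFb _ _ (hmeas j) ((integrable_mollify j hgi).sub hgi)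
    rw [← integral_add i1 (hFb _ _ (hmeas j) hgi)]
    refine integral_congr_ae (Eventually.of_forall fun x => ?_)
    simp only; ring
  have hfinal := tendsto_nhds_unique (hL.congr' happrox) hR.neg
  have e1 : ∫ x in Ω, F (u x) * fderiv ℝ φ x e = ∫ x, F (f x) * fderiv ℝ φ x e := by
    rw [← setIntegral_eq_integral_of_forall_compl_eq_zero (s := Ω) (μ := volume)
      (f := fun x => F (f x) * fderiv ℝ φ x e)]
    · refine integral_congr_ae (Eventually.of_forall fun t => ?_)
      by_cases ht : t ∈ K
      · simp only [hf, indicator_of_mem ht]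
      · simp [hdφK t ht]
    · intro t ht
      simp [hdφK t fun hk => ht (hδΩ hk)]
  have e2 : ∫ x in Ω, F' (u x) * inner ℝ (Du x) e * φ x = ∫ x, F' (f x) * g x * φ x := by
    rw [← setIntegral_eq_integral_of_forall_compl_eq_zero (s := Ω) (μ := volume)
      (f := fun x => F' (f x) * g x * φ x)]
    · refine integral_congr_ae (Eventually.of_forall fun t => ?_)
      by_cases ht : t ∈ K
      · simp only [hf, hg, indicator_of_mem ht]
      · simp [hφK t ht]
    · intro t ht
      simp [hφK t fun hk => ht (hδΩ hk)]
  rw [e1, e2, hfinal]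

end IsWeakGradient

/-- A `C¹` approximation of the positive part. -/
noncomputable def posApprox (j : ℕ) (t : ℝ) : ℝ := ∫ s in (0 : ℝ)..t, min 1 (j * max s 0)

/-- The derivative of `posApprox`. -/
noncomputable def posApproxDeriv (j : ℕ) (t : ℝ) : ℝ := min 1 (j * max t 0)

lemma continuous_posApproxDeriv (j : ℕ) : Continuous (posApproxDeriv j) := by
  unfold posApproxDeriv; fun_prop

lemma posApproxDeriv_nonneg (j : ℕ) (t : ℝ) : 0 ≤ posApproxDeriv j t :=
  le_min zero_le_one (by positivity)

lemma abs_posApproxDeriv_le (j : ℕ) (t : ℝ) : |posApproxDeriv j t| ≤ 1 := by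
  rw [abs_of_nonneg (posApproxDeriv_nonneg j t)]; exact min_le_left _ _

lemma hasDerivAt_posApprox (j : ℕ) (t : ℝ) : HasDerivAt (posApprox j) (posApproxDeriv j t) t :=
  intervalIntegral.integral_hasDerivAt_right
    ((continuous_posApproxDeriv j).intervalIntegrable _ _)
    ((continuous_posApproxDeriv j).stronglyMeasurableAtFilter _ _)
    (continuous_posApproxDeriv j).continuousAt

lemma tendsto_posApproxDeriv (t : ℝ) :
    Tendsto (fun j => posApproxDeriv j t) atTop (𝓝 (if 0 < t then 1 else 0)) := by
  split_ifs with ht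
  · refine tendsto_const_nhds.congr' ?_
    filter_upwards [(tendsto_natCast_atTop_atTop (R := ℝ)).eventually_ge_atTop t⁻¹] with j hj
    rw [posApproxDeriv, max_eq_left ht.le, min_eq_left]
    rw [inv_eq_one_div, div_le_iff₀ ht] at hj
    exact hj
  · refine tendsto_const_nhds.congr fun j => ?_
    rw [posApproxDeriv, max_eq_right (not_lt.1 ht)]; simp

lemma tendsto_posApprox (t : ℝ) : Tendsto (fun j => posApprox j t) atTop (𝓝 (max t 0)) := by
  have h1 : Tendsto (fun j => posApprox j t) atTop
      (𝓝 (∫ s in (0 : ℝ)..t, if 0 < s then (1 : ℝ) else 0)) :=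
    intervalIntegral.tendsto_integral_filter_of_dominated_convergence (fun _ => 1)
      (Eventually.of_forall fun j => (continuous_posApproxDeriv j).aestronglyMeasurable)
      (Eventually.of_forall fun j => Eventually.of_forall fun s _ => abs_posApproxDeriv_le j s)
      intervalIntegrable_const (Eventually.of_forall fun s _ => tendsto_posApproxDeriv s)
  convert h1 using 2
  rcases le_total 0 t with ht | ht
  · rw [max_eq_left ht, intervalIntegral.integral_congr_ae (g := fun _ => (1 : ℝ))]
    · simp
    · refine Eventually.of_forall fun s hs => ?_
      rw [uIoc_of_le ht] at hs
      simp [hs.1]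
  · rw [max_eq_right ht, intervalIntegral.integral_congr_ae (g := fun _ => (0 : ℝ))]
    · simp
    · refine Eventually.of_forall fun s hs => ?_
      rw [uIoc_of_ge ht] at hs
      simp [hs.2]

lemma abs_posApprox_le (j : ℕ) (t : ℝ) : |posApprox j t| ≤ |t| := by
  have := intervalIntegral.norm_integral_le_of_norm_le_const (a := 0) (b := t) (C := 1)
    (f := posApproxDeriv j) fun s _ => abs_posApproxDeriv_le j s
  simpa [posApprox, posApproxDeriv] using this

namespace IsWeakGradient

variable {Ω : Set (E n)} {u : E n → ℝ} {Du : E n → E n}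

lemma aemeasurable (h : IsWeakGradient Ω u Du) : AEMeasurable u (volume.restrict Ω) :=
  h.locInt.aestronglyMeasurable.aemeasurable

lemma integrable_mul_test (h : IsWeakGradient Ω u Du) {ψ : E n → ℝ} (hψ : Continuous ψ)
    (hψc : HasCompactSupport ψ) (hψΩ : tsupport ψ ⊆ Ω) :
    IntegrableOn (fun x => u x * ψ x) Ω := by
  obtain ⟨C, hC⟩ := hψc.exists_bound_of_continuous hψ
  have := (h.integrable_indicator (show IsCompact (tsupport ψ) from hψc) hψΩ).mul_bdd
    hψ.aestronglyMeasurable (Eventually.of_forall hC)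
  refine this.integrableOn.congr (Eventually.of_forall fun x => ?_)
  by_cases hx : x ∈ tsupport ψ
  · simp only [indicator_of_mem hx]
  · simp [image_eq_zero_of_notMem_tsupport hx]

lemma integrable_inner_mul_test (h : IsWeakGradient Ω u Du) {ψ : E n → ℝ} (hψ : Continuous ψ)
    (hψc : HasCompactSupport ψ) (hψΩ : tsupport ψ ⊆ Ω) (e : E n) :
    IntegrableOn (fun x => inner ℝ (Du x) e * ψ x) Ω := by
  obtain ⟨C, hC⟩ := hψc.exists_bound_of_continuous hψ
  have := (h.integrable_indicator_inner (show IsCompact (tsupport ψ) from hψc) hψΩ e).mul_bdd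
    hψ.aestronglyMeasurable (Eventually.of_forall hC)
  refine this.integrableOn.congr (Eventually.of_forall fun x => ?_)
  by_cases hx : x ∈ tsupport ψ
  · simp only [indicator_of_mem hx]
  · simp [image_eq_zero_of_notMem_tsupport hx]

/-- Passage to the limit in the chain rule along `posApprox`. The approximate derivatives vanish at
t ≤ 0 and tend to 1 for t > 0, so the set {u = 0} needs no separate argument. -/
lemma posPart (h : IsWeakGradient Ω u Du) (hΩ : IsOpen Ω) :
    IsWeakGradient Ω (fun x => max (u x) 0) (fun x => if 0 < u x then Du x else 0) := by
  have hu := h.aemeasurable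
  have hmeas : NullMeasurableSet {x | 0 < u x} (volume.restrict Ω) :=
    nullMeasurableSet_lt aemeasurable_const hu
  have hDm : AEStronglyMeasurable (fun x => if 0 < u x then Du x else 0) (volume.restrict Ω) :=
    h.locInt_grad.aestronglyMeasurable.indicator₀ hmeas
  refine ⟨locallyIntegrableOn_of_le hΩ h.locInt (hu.max aemeasurable_const).aestronglyMeasurable
    (Eventually.of_forall fun x => ?_), locallyIntegrableOn_of_le hΩ h.locInt_grad hDm
    (Eventually.of_forall fun x => ?_), fun φ hφ hφc hφΩ e => ?_⟩
  · rw [Real.norm_of_nonneg (le_max_right _ _)]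
    exact max_le (le_abs_self _) (abs_nonneg _)
  · split_ifs <;> simp
  have hK : IsCompact (tsupport φ) := hφc
  have hdφc : Continuous fun x => fderiv ℝ φ x e :=
    (hφ.continuous_fderiv (by simp)).clm_apply continuous_const
  obtain ⟨C₁, hC₁⟩ := (hφc.fderiv_apply ℝ e).exists_bound_of_continuous hdφc
  obtain ⟨C₂, hC₂⟩ := hφc.exists_bound_of_continuous hφ.continuous
  have hj := fun j => h.integral_comp_mul_fderiv hΩ (hasDerivAt_posApprox j)
    (continuous_posApproxDeriv j) (abs_posApproxDeriv_le j) hφ hφc hφΩ e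
  have hc : ∀ j, Continuous (posApprox j) := fun j =>
    continuous_iff_continuousAt.2 fun t => (hasDerivAt_posApprox j t).continuousAt
  have hL : Tendsto (fun j => ∫ x in Ω, posApprox j (u x) * fderiv ℝ φ x e) atTop
      (𝓝 (∫ x in Ω, max (u x) 0 * fderiv ℝ φ x e)) := by
    refine tendsto_integral_of_dominated_convergence
      (fun x => |(tsupport φ).indicator u x| * C₁)
      (fun j => ((hc j).comp_aestronglyMeasurable hu.aestronglyMeasurable).mul
        hdφc.aestronglyMeasurable)
      ((h.integrable_indicator hK hφΩ).abs.mul_const _).integrableOn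
      (fun j => Eventually.of_forall fun x => ?_)
      (Eventually.of_forall fun x => (tendsto_posApprox _).mul_const _)
    by_cases hx : x ∈ tsupport φ
    · rw [indicator_of_mem hx, norm_mul]
      exact mul_le_mul (abs_posApprox_le _ _) (hC₁ x) (norm_nonneg _) (abs_nonneg _)
    · rw [image_eq_zero_of_notMem_tsupport fun hm => hx (tsupport_fderiv_subset ℝ hm)]
      simp [indicator_of_notMem hx]
  have hR : Tendsto (fun j => ∫ x in Ω, posApproxDeriv j (u x) * inner ℝ (Du x) e * φ x) atTop
      (𝓝 (∫ x in Ω, inner ℝ (if 0 < u x then Du x else 0) e * φ x)) := by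
    refine tendsto_integral_of_dominated_convergence
      (fun x => |(tsupport φ).indicator (fun y => inner ℝ (Du y) e) x| * C₂)
      (fun j => (((continuous_posApproxDeriv j).comp_aestronglyMeasurable
        hu.aestronglyMeasurable).mul (h.locInt_grad.aestronglyMeasurable.inner
          aestronglyMeasurable_const)).mul hφ.continuous.aestronglyMeasurable)
      ((h.integrable_indicator_inner hK hφΩ e).abs.mul_const _).integrableOn
      (fun j => Eventually.of_forall fun x => ?_)
      (Eventually.of_forall fun x => ?_)
    · by_cases hx : x ∈ tsupport φ
      · rw [indicator_of_mem hx, norm_mul, norm_mul]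
        refine mul_le_mul ?_ (hC₂ x) (norm_nonneg _) (abs_nonneg _)
        exact mul_le_of_le_one_left (norm_nonneg _) (abs_posApproxDeriv_le _ _)
      · rw [image_eq_zero_of_notMem_tsupport hx]
        simp [indicator_of_notMem hx]
    · have := ((tendsto_posApproxDeriv (u x)).mul_const (inner ℝ (Du x) e)).mul_const (φ x)
      convert this using 2
      split_ifs <;> simp
  exact tendsto_nhds_unique (hL.congr hj) hR.neg

lemma sub_const (h : IsWeakGradient Ω u Du) (k : ℝ) :
    IsWeakGradient Ω (fun x => u x - k) Du := by
  refine ⟨h.locInt.sub (locallyIntegrableOn_const k), h.locInt_grad, fun φ hφ hφc hφΩ e => ?_⟩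
  have hdφc : Continuous fun x => fderiv ℝ φ x e :=
    (hφ.continuous_fderiv (by simp)).clm_apply continuous_const
  have hdφs : HasCompactSupport fun x => fderiv ℝ φ x e := hφc.fderiv_apply ℝ e
  have hdφt : tsupport (fun x => fderiv ℝ φ x e) ⊆ Ω :=
    (tsupport_fderiv_apply_subset ℝ e).trans hφΩ
  have hint := hdφc.integrable_of_hasCompactSupport hdφs (μ := volume)
  -- Integration by parts against the constant 1 shows that constants have weak gradient zero.
  have h0 : ∫ x in Ω, fderiv ℝ φ x e = 0 := by
    rw [setIntegral_eq_integral_of_forall_compl_eq_zero fun x hx =>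
      image_eq_zero_of_notMem_tsupport fun hm => hx (hdφt hm)]
    have := integral_mul_fderiv_eq_neg_fderiv_mul_of_integrable (μ := volume) (f := fun _ => (1 : ℝ))
      (g := φ) (v := e) (by simp) (by simpa using hint)
      (by simpa using hφ.continuous.integrable_of_hasCompactSupport hφc)
      (fun _ _ => differentiableAt_const _) (fun x _ => hφ.differentiable (by simp) x)
    simpa using this
  simp only [sub_mul]
  rw [integral_sub (h.integrable_mul_test hdφc hdφs hdφt) (hint.integrableOn.const_mul k),
    integral_const_mul, h0, h.parts φ hφ hφc hφΩ e]
  ring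

lemma neg (h : IsWeakGradient Ω u Du) :
    IsWeakGradient Ω (fun x => -u x) (fun x => -Du x) := by
  refine ⟨h.locInt.neg, h.locInt_grad.neg, fun φ hφ hφc hφΩ e => ?_⟩
  simp only [neg_mul, inner_neg_left, integral_neg, h.parts φ hφ hφc hφΩ e]

/-- The product ψφ is again a test function, so the weak formula for u with ψφ and the Leibniz rule
give the claim. -/
lemma mul_smooth (h : IsWeakGradient Ω u Du) (hΩ : IsOpen Ω) {ψ : E n → ℝ}
    (hψ : ContDiff ℝ (⊤ : ℕ∞) ψ) :
    IsWeakGradient Ω (fun x => ψ x * u x) (fun x => ψ x • Du x + u x • gradient ψ x) := by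
  have hgc : Continuous (gradient ψ) :=
    (InnerProductSpace.toDual ℝ (E n)).symm.continuous.comp (hψ.continuous_fderiv (by simp))
  refine ⟨h.locInt.continuousOn_mul hψ.continuous.continuousOn hΩ.isLocallyClosed,
    (h.locInt_grad.continuousOn_smul hΩ.isLocallyClosed hψ.continuous.continuousOn).add
      (h.locInt.smul_continuousOn hΩ.isLocallyClosed hgc.continuousOn), fun φ hφ hφc hφΩ e => ?_⟩
  have hψφ : ContDiff ℝ (⊤ : ℕ∞) fun x => ψ x * φ x := hψ.mul hφ
  have hψφc : HasCompactSupport fun x => ψ x * φ x := hφc.mul_left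
  have hψφΩ : tsupport (fun x => ψ x * φ x) ⊆ Ω :=
    (closure_mono (Function.support_mul_subset_right _ _)).trans hφΩ
  have hdφc : Continuous fun x => fderiv ℝ φ x e :=
    (hφ.continuous_fderiv (by simp)).clm_apply continuous_const
  have hdψc : Continuous fun x => fderiv ℝ ψ x e :=
    (hψ.continuous_fderiv (by simp)).clm_apply continuous_const
  have hd : ∀ x, fderiv ℝ (fun x => ψ x * φ x) x e =
      ψ x * fderiv ℝ φ x e + fderiv ℝ ψ x e * φ x := by
    intro x
    rw [fderiv_fun_mul (hψ.differentiable (by simp) x) (hφ.differentiable (by simp) x)]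
    simp; ring
  have key := h.parts _ hψφ hψφc hψφΩ e
  simp only [hd, mul_add] at key
  have i1 : IntegrableOn (fun x => u x * (ψ x * fderiv ℝ φ x e)) Ω :=
    h.integrable_mul_test (hψ.continuous.mul hdφc) (hφc.fderiv_apply ℝ e).mul_left
      ((closure_mono (Function.support_mul_subset_right _ _)).trans
        ((tsupport_fderiv_apply_subset ℝ e).trans hφΩ))
  have i2 : IntegrableOn (fun x => u x * (fderiv ℝ ψ x e * φ x)) Ω :=
    h.integrable_mul_test (hdψc.mul hφ.continuous) hφc.mul_left
      ((closure_mono (Function.support_mul_subset_right _ _)).trans hφΩ)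
  have i3 : IntegrableOn (fun x => inner ℝ (Du x) e * (ψ x * φ x)) Ω :=
    h.integrable_inner_mul_test hψφ.continuous hψφc hψφΩ e
  rw [integral_add i1 i2] at key
  have e1 : ∫ x in Ω, ψ x * u x * fderiv ℝ φ x e = ∫ x in Ω, u x * (ψ x * fderiv ℝ φ x e) :=
    integral_congr_ae (Eventually.of_forall fun x => by simp only; ring)
  have e2 : ∫ x in Ω, inner ℝ (ψ x • Du x + u x • gradient ψ x) e * φ x =
      (∫ x in Ω, inner ℝ (Du x) e * (ψ x * φ x)) + ∫ x in Ω, u x * (fderiv ℝ ψ x e * φ x) := by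
    rw [← integral_add i3 i2]
    refine integral_congr_ae (Eventually.of_forall fun x => ?_)
    have : inner ℝ (gradient ψ x) e = fderiv ℝ ψ x e := by
      simp [gradient]
    simp only [inner_add_left, inner_smul_left, this]
    simp; ring
  rw [e1, e2]
  linarith

end IsWeakGradient

end DGNeumann

namespace DGNeumann

variable {n : ℕ}

/-! ### Cutoff functions -/

lemma exists_lipschitz_smoothTransition : ∃ C : NNReal, LipschitzWith C Real.smoothTransition := by
  have hs : ContDiff ℝ 1 Real.smoothTransition := Real.smoothTransition.contDiff
  obtain ⟨C, hC⟩ := isCompact_Icc.exists_bound_of_continuousOn (s := Icc (0 : ℝ) 1)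
    (hs.continuous_deriv le_rfl).continuousOn
  refine ⟨C.toNNReal, lipschitzWith_of_nnnorm_deriv_le (hs.differentiable one_ne_zero) fun x => ?_⟩
  rw [← NNReal.coe_le_coe, coe_nnnorm]
  refine le_trans ?_ (Real.le_coe_toNNReal C)
  have hC0 : 0 ≤ C := (norm_nonneg _).trans (hC 0 (by simp))
  by_cases hx : x ∈ Icc (0 : ℝ) 1
  · exact hC x hx
  · have hx' : x < 0 ∨ 1 < x := by
      by_contra! h; exact hx ⟨h.1, h.2⟩
    rcases hx' with hx | hx
    · have : Real.smoothTransition =ᶠ[𝓝 x] fun _ => 0 := by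
        filter_upwards [gt_mem_nhds hx] with y hy
        exact Real.smoothTransition.zero_of_nonpos hy.le
      rw [this.deriv_eq]; simpa
    · have : Real.smoothTransition =ᶠ[𝓝 x] fun _ => 1 := by
        filter_upwards [lt_mem_nhds hx] with y hy
        exact Real.smoothTransition.one_of_one_le hy.le
      rw [this.deriv_eq]; simpa

/-- `φ` is a smooth cutoff between the balls of radii `ρ - σρ` and `ρ` around `z`. -/
structure IsCutoff (C : ℝ) (z : E n) (ρ σ : ℝ) (φ : E n → ℝ) : Prop where
  smooth : ContDiff ℝ (⊤ : ℕ∞) φ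
  nonneg : ∀ x, 0 ≤ φ x
  le_one : ∀ x, φ x ≤ 1
  eq_one : ∀ x ∈ Metric.ball z (ρ - σ * ρ), φ x = 1
  eq_zero : ∀ x, x ∉ Metric.ball z ρ → φ x = 0
  gradient_le : ∀ x, ‖gradient φ x‖ ≤ C / (σ * ρ)

/-- The gradient bound of the cutoff functions does not depend on the dimension. -/
lemma exists_isCutoff : ∃ C : ℝ, 0 < C ∧ ∀ (n : ℕ) (z : E n) (ρ σ : ℝ), 0 < ρ → 0 < σ → σ < 1 →
    ∃ φ, IsCutoff C z ρ σ φ := by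
  obtain ⟨C, hC⟩ := exists_lipschitz_smoothTransition
  refine ⟨C + 1, by positivity, fun n z ρ σ hρ hσ hσ1 => ?_⟩
  have hσρ : 0 < σ * ρ := mul_pos hσ hρ
  set φ : E n → ℝ := fun x => Real.smoothTransition ((ρ - dist x z) / (σ * ρ)) with hφ
  have h1 : ∀ x ∈ Metric.ball z (ρ - σ * ρ), φ x = 1 := by
    intro x hx
    rw [Metric.mem_ball] at hx
    apply Real.smoothTransition.one_of_one_le
    rw [le_div_iff₀ hσρ]; linarith
  refine ⟨φ, ?_, fun x => Real.smoothTransition.nonneg _, fun x => Real.smoothTransition.le_one _,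
    h1, ?_, ?_⟩
  · rw [contDiff_iff_contDiffAt]
    intro x
    -- The distance to z is not smooth at z, but the cutoff is constant near the centre.
    rcases eq_or_ne x z with rfl | hx
    · have : φ =ᶠ[𝓝 x] fun _ => 1 := by
        have hpos : 0 < ρ - σ * ρ := by nlinarith
        filter_upwards [Metric.ball_mem_nhds x hpos] with y hy using h1 y hy
      exact contDiffAt_const.congr_of_eventuallyEq this
    · refine Real.smoothTransition.contDiff.contDiffAt.comp x ?_
      refine ContDiffAt.div_const (contDiffAt_const.sub ?_) _
      exact contDiffAt_id.dist ℝ contDiffAt_const hx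
  · intro x hx
    rw [Metric.mem_ball, not_lt] at hx
    exact Real.smoothTransition.zero_of_nonpos (div_nonpos_of_nonpos_of_nonneg (by linarith) hσρ.le)
  · intro x
    have hlip : LipschitzWith (C * (σ * ρ)⁻¹.toNNReal) φ := by
      refine hC.comp (LipschitzWith.of_dist_le_mul fun x y => ?_)
      rw [Real.coe_toNNReal _ (by positivity), Real.dist_eq, ← sub_div, abs_div, abs_of_pos hσρ,
        div_eq_inv_mul]
      refine mul_le_mul_of_nonneg_left ?_ (by positivity)
      rw [sub_sub_sub_cancel_left, abs_sub_comm]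
      exact abs_dist_sub_le x y z
    have := norm_fderiv_le_of_lipschitz ℝ hlip (x₀ := x)
    rw [gradient, LinearIsometryEquiv.norm_map]
    refine this.trans ?_
    rw [NNReal.coe_mul, Real.coe_toNNReal _ (by positivity), ← div_eq_mul_inv]
    gcongr; linarith

lemma gradient_pow {φ : E n → ℝ} {x : E n} (h : DifferentiableAt ℝ φ x) (q : ℕ) :
    gradient (fun y => φ y ^ q) x = (q * φ x ^ (q - 1)) • gradient φ x := by
  rw [gradient, fderiv_fun_pow q h, gradient, map_smul, nsmul_eq_mul]

/-! ### Carathéodory functions -/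

/-- The null set on which f(·, p) differs from a measurable representative depends on p. A countable
dense set of parameters leaves a single null set; off it, continuity in p recovers measurability for
every p, and hence joint measurability. -/
lemma Caratheodory.aemeasurable_comp {X Y Z : Type*} [MeasurableSpace X] [TopologicalSpace Y]
    [TopologicalSpace.MetrizableSpace Y] [SecondCountableTopology Y] [MeasurableSpace Y]
    [BorelSpace Y] [Nonempty Y]
    [TopologicalSpace Z] [TopologicalSpace.PseudoMetrizableSpace Z] [MeasurableSpace Z]
    [BorelSpace Z] [Zero Z] {μ : Measure X} {f : X → Y → Z} (hf : Caratheodory μ f) {w : X → Y}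
    (hw : AEMeasurable w μ) : AEMeasurable (fun x => f x (w x)) μ := by
  classical
  have hae : ∀ᵐ x ∂μ, Continuous (f x) ∧ ∀ i,
      f x (TopologicalSpace.denseSeq Y i) = (hf.1 (TopologicalSpace.denseSeq Y i)).mk _ x :=
    hf.2.and (ae_all_iff.2 fun i => (hf.1 _).ae_eq_mk)
  set S := (toMeasurable μ {x | ¬ (Continuous (f x) ∧ ∀ i,
      f x (TopologicalSpace.denseSeq Y i) = (hf.1 (TopologicalSpace.denseSeq Y i)).mk _ x)})ᶜ
    with hS
  have hSm : MeasurableSet S := (measurableSet_toMeasurable _ _).compl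
  have hSsub : ∀ x ∈ S, Continuous (f x) ∧ ∀ i,
      f x (TopologicalSpace.denseSeq Y i) = (hf.1 (TopologicalSpace.denseSeq Y i)).mk _ x := by
    intro x hx
    by_contra h
    exact hx (subset_toMeasurable _ _ h)
  have hSae : ∀ᵐ x ∂μ, x ∈ S := by
    rw [ae_iff]
    simp only [hS, mem_compl_iff, not_not, ofPred_mem_eq, measure_toMeasurable]
    exact hae
  set f' : X → Y → Z := fun x p => if x ∈ S then f x p else 0 with hf'
  have hc : ∀ x, Continuous (f' x) := by
    intro x
    by_cases hx : x ∈ S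
    · simpa [hf', hx] using (hSsub x hx).1
    · simpa [hf', hx] using continuous_const
  have hm0 : ∀ i, Measurable fun x => f' x (TopologicalSpace.denseSeq Y i) := by
    intro i
    have : (fun x => f' x (TopologicalSpace.denseSeq Y i)) =
        fun x => if x ∈ S then (hf.1 (TopologicalSpace.denseSeq Y i)).mk _ x else 0 := by
      ext x
      by_cases hx : x ∈ S
      · simp [hf', hx, (hSsub x hx).2 i]
      · simp [hf', hx]
    rw [this]
    exact Measurable.ite hSm (hf.1 _).measurable_mk measurable_const
  have hm : ∀ p, Measurable fun x => f' x p := by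
    intro p
    obtain ⟨s, hs, hlim⟩ := mem_closure_iff_seq_limit.1
      ((TopologicalSpace.denseRange_denseSeq Y) p)
    choose i hi using hs
    refine measurable_of_tendsto_metrizable (f := fun k x => f' x (s k)) (fun k => ?_)
      (tendsto_pi_nhds.2 fun x => ((hc x).tendsto p).comp hlim)
    simpa only [← hi k] using hm0 (i k)
  have hunc : Measurable (Function.uncurry fun p x => f' x p) :=
    measurable_uncurry_of_continuous_of_measurable hc hm
  refine ⟨fun x => f' x (hw.mk w x), hunc.comp (hw.measurable_mk.prodMk measurable_id), ?_⟩
  filter_upwards [hSae, hw.ae_eq_mk] with x hx hwx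
  simp [hf', hx, ← hwx]

/-! ### Power growth of generalized N-functions -/

lemma dens_of_nonneg (G : E n → ℝ → ℝ) (x : E n) {t : ℝ} (ht : 0 ≤ t) :
    dens G x t = derivWithin (G x) (Ici t) t := if_pos ht

lemma IsGenNFunction.ae_powerGrowth {S : Set (E n)} (hS : MeasurableSet S) {G : E n → ℝ → ℝ}
    (h : IsGenNFunction S G) {m p : ℝ}
    (hd : ∀ x ∈ S, ∀ t, 0 < t → m ≤ dens G x t * t / G x t ∧ dens G x t * t / G x t ≤ p) :
    ∀ᵐ x ∂(volume.restrict S), PowerGrowth (G x) m p := by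
  filter_upwards [h.even, h.convex, h.lim_zero, h.lim_infty, ae_restrict_mem hS]
    with x h1 h2 h3 h4 hx
  refine ⟨h2, h1, h.zero x hx, h.pos x hx, h3, h4, fun t ht => ?_, fun t ht => ?_⟩
  · rw [← dens_of_nonneg G x ht.le]; exact (hd x hx t ht).1
  · rw [← dens_of_nonneg G x ht.le]; exact (hd x hx t ht).2

section MemL

variable {Ω : Set (E n)} {G : E n → ℝ → ℝ} {m p F : ℝ}

/-- The upper exponent makes G doubling, so the scaling l in the definition of the space can be
removed at the cost of the factor (1 + 1/l)^p. -/
lemma MemL.integrableOn (hG : ∀ᵐ x ∂(volume.restrict Ω), PowerGrowth (G x) m p)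
    (hc : Caratheodory (volume.restrict Ω) G) {f : E n → ℝ} (hf : MemL Ω G f) :
    IntegrableOn (fun x => G x (f x)) Ω := by
  obtain ⟨hfm, l, hl, hfin⟩ := hf
  have hi : IntegrableOn (fun x => G x (l * f x)) Ω := by
    refine ⟨(hc.aemeasurable_comp (hfm.const_mul l)).aestronglyMeasurable, ?_⟩
    rw [hasFiniteIntegral_iff_ofReal]
    · exact hfin
    · filter_upwards [hG] with x hx
      rw [Pi.zero_apply, ← hx.abs_eq]
      exact hx.nonneg (abs_nonneg _)
  refine Integrable.mono' (hi.const_mul ((1 + l⁻¹) ^ p))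
    (hc.aemeasurable_comp hfm).aestronglyMeasurable ?_
  filter_upwards [hG] with x hx
  rw [← hx.abs_eq, Real.norm_of_nonneg (hx.nonneg (abs_nonneg _)), ← hx.abs_eq (l * f x)]
  have hl' : 0 < l⁻¹ := inv_pos.2 hl
  refine le_trans (hx.mono (mem_Ici.2 (abs_nonneg _)) ?_ ?_)
    (hx.scale_le (l := 1 + l⁻¹) (by linarith) (abs_nonneg _))
  · exact mem_Ici.2 (mul_nonneg (by linarith) (abs_nonneg _))
  · rw [abs_mul, abs_of_pos hl, add_mul, inv_mul_cancel_left₀ hl.ne', one_mul]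
    have := mul_nonneg hl.le (abs_nonneg (f x))
    linarith

lemma memL_of_integrableOn {f : E n → ℝ} (hf : AEMeasurable f (volume.restrict Ω))
    (hi : IntegrableOn (fun x => G x (f x)) Ω) : MemL Ω G f := by
  refine ⟨hf, 1, one_pos, ?_⟩
  simp only [one_mul]
  refine lt_of_le_of_lt (lintegral_mono fun x => ?_) hi.2
  exact Real.ofReal_le_enorm _

lemma integrableOn_comp_of_bound (hΩ : volume Ω ≠ ⊤)
    (hG : ∀ᵐ x ∂(volume.restrict Ω), PowerGrowth (G x) m p)
    (hc : Caratheodory (volume.restrict Ω) G) (hF : ∀ᵐ x ∂(volume.restrict Ω), G x 1 ≤ F)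
    {f : E n → ℝ} (hf : AEMeasurable f (volume.restrict Ω)) {c : ℝ}
    (hfc : ∀ᵐ x ∂(volume.restrict Ω), |f x| ≤ c) : IntegrableOn (fun x => G x (f x)) Ω := by
  have hconst : IntegrableOn (fun _ : E n => (1 + c) ^ p * F) Ω := integrableOn_const hΩ
  refine Integrable.mono' hconst (hc.aemeasurable_comp hf).aestronglyMeasurable ?_
  filter_upwards [hG, hF, hfc] with x hx hFx hfx
  rw [← hx.abs_eq, Real.norm_of_nonneg (hx.nonneg (abs_nonneg _))]
  have hc0 : 0 ≤ c := (abs_nonneg _).trans hfx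
  refine (hx.mono (mem_Ici.2 (abs_nonneg _)) hc0 hfx).trans ((hx.le_one_add_rpow hc0).trans ?_)
  gcongr

end MemL

/-! ### Test functions -/

section TestFunction

variable {Ω : Set (E n)} {G : E n → ℝ → ℝ} {m p F M k : ℝ} {w : E n → ℝ} {Dw : E n → E n}
  {ψ : E n → ℝ}

/-- The function is bounded on a set of finite measure, and its gradient is at most |Dw| plus a
constant; the quasi-triangle inequality `PowerGrowth.add_le` then gives integrability. -/
lemma memW_cutoff_mul_posPart (hΩ : IsOpen Ω) (hΩv : volume Ω ≠ ⊤)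
    (hG : ∀ᵐ x ∂(volume.restrict Ω), PowerGrowth (G x) m p)
    (hc : Caratheodory (volume.restrict Ω) G) (hF : ∀ᵐ x ∂(volume.restrict Ω), G x 1 ≤ F)
    (hw : MemW Ω G w Dw) (hwM : ∀ᵐ x ∂(volume.restrict Ω), |w x| ≤ M)
    (hψ : ContDiff ℝ (⊤ : ℕ∞) ψ) (hψ0 : ∀ x, 0 ≤ ψ x) (hψ1 : ∀ x, ψ x ≤ 1) {L : ℝ}
    (hL : ∀ x, ‖gradient ψ x‖ ≤ L) :
    MemW Ω G (fun x => ψ x * max (w x - k) 0)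
      (fun x => ψ x • (if 0 < w x - k then Dw x else 0) + max (w x - k) 0 • gradient ψ x) := by
  have hgrad := ((hw.grad.sub_const k).posPart hΩ).mul_smooth hΩ hψ
  have hbd : ∀ x, |w x| ≤ M → max (w x - k) 0 ≤ M + |k| := fun x hx => by
    refine max_le ?_ (by positivity [(abs_nonneg (w x)).trans hx])
    linarith [le_abs_self (w x), neg_abs_le k]
  refine ⟨memL_of_integrableOn hgrad.aemeasurable (integrableOn_comp_of_bound hΩv hG hc hF
    hgrad.aemeasurable (c := M + |k|) ?_), hgrad, ?_⟩
  · filter_upwards [hwM] with x hx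
    rw [abs_of_nonneg (mul_nonneg (hψ0 x) (le_max_right _ _))]
    exact (mul_le_of_le_one_left (le_max_right _ _) (hψ1 x)).trans (hbd x hx)
  have hm := hgrad.locInt_grad.aestronglyMeasurable.norm.aemeasurable
  refine memL_of_integrableOn hm ?_
  have i1 := hw.mem_grad.integrableOn hG hc
  have i2 : IntegrableOn (fun x => G x ((M + |k|) * L)) Ω :=
    integrableOn_comp_of_bound hΩv hG hc hF aemeasurable_const
      (Eventually.of_forall fun _ => le_rfl)
  refine Integrable.mono' ((i1.add i2).const_mul (2 ^ p))
    (hc.aemeasurable_comp hm).aestronglyMeasurable ?_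
  filter_upwards [hG, hwM] with x hx hwx
  rw [Real.norm_of_nonneg (hx.nonneg (norm_nonneg _))]
  have hM : 0 ≤ M := (abs_nonneg _).trans hwx
  have hL0 : 0 ≤ L := (norm_nonneg _).trans (hL x)
  have hc0 : 0 ≤ (M + |k|) * L := by positivity
  refine (hx.mono (norm_nonneg _) (add_nonneg (norm_nonneg _) hc0) ?_).trans
    (hx.add_le (norm_nonneg (Dw x)) hc0)
  refine (norm_add_le _ _).trans (add_le_add ?_ ?_)
  · rw [norm_smul, Real.norm_of_nonneg (hψ0 x)]
    refine (mul_le_of_le_one_left (norm_nonneg _) (hψ1 x)).trans ?_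
    split_ifs <;> simp
  · rw [norm_smul, Real.norm_of_nonneg (le_max_right _ _)]
    exact mul_le_mul (hbd x hwx) (hL x) (norm_nonneg _) (by positivity)

lemma laverage_le_of_ae_le {s : Set (E n)} {f : E n → ℝ≥0∞} {c : ℝ≥0∞}
    (h : ∀ᵐ y ∂(volume.restrict s), f y ≤ c) : ⨍⁻ y in s, f y ∂volume ≤ c := by
  rw [setLAverage_eq]
  refine ENNReal.div_le_of_le_mul ((lintegral_mono_ae h).trans ?_)
  simp

/-- At a boundary point x in the ball, τ(x) ≤ k gives ψ (w - k)⁺ ≤ |w - τ(x)|, whose averages tend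
to 0. At the other points ψ(x) = 0, and continuity of ψ with boundedness of w suffices. -/
lemma isTrace_zero {z : E n} {ρ : ℝ} {τ : E n → ℝ} (hΩ : IsOpen Ω) (hτ : IsTrace Ω w τ)
    (hwM : ∀ᵐ x ∂(volume.restrict Ω), |w x| ≤ M)
    (hψ : Continuous ψ) (hψ0 : ∀ x, 0 ≤ ψ x) (hψ1 : ∀ x, ψ x ≤ 1)
    (hψz : ∀ x, x ∉ Metric.ball z ρ → ψ x = 0)
    (hk : ∀ᵐ x ∂((surf Ω).restrict (Metric.ball z ρ)), τ x ≤ k) :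
    IsTrace Ω (fun x => ψ x * max (w x - k) 0) (fun _ => 0) := by
  have hk' := (ae_restrict_iff' Metric.isOpen_ball.measurableSet).1 hk
  filter_upwards [hτ, hk'] with x hx hkx
  by_cases hxz : x ∈ Metric.ball z ρ
  · refine tendsto_of_tendsto_of_tendsto_of_le_of_le tendsto_const_nhds hx (fun _ => zero_le)
      fun r => ?_
    refine lintegral_mono fun y => ENNReal.ofReal_le_ofReal ?_
    rw [sub_zero, abs_of_nonneg (mul_nonneg (hψ0 y) (le_max_right _ _))]
    refine (mul_le_of_le_one_left (le_max_right _ _) (hψ1 y)).trans (max_le ?_ (abs_nonneg _))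
    linarith [hkx hxz, le_abs_self (w y - τ x)]
  · have h0 : ψ x = 0 := hψz x hxz
    have hlim : Tendsto (fun y => ENNReal.ofReal (ψ y * (M + |k|))) (𝓝 x) (𝓝 0) := by
      have : Continuous fun y => ENNReal.ofReal (ψ y * (M + |k|)) :=
        ENNReal.continuous_ofReal.comp (hψ.mul continuous_const)
      simpa [h0] using this.tendsto x
    rw [ENNReal.tendsto_nhds_zero]
    intro ε hε
    obtain ⟨r₀, hr₀, hr⟩ := Metric.eventually_nhds_iff_ball.1 (ENNReal.tendsto_nhds_zero.1 hlim ε hε)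
    filter_upwards [Ioo_mem_nhdsGT hr₀] with r hrr
    refine laverage_le_of_ae_le ?_
    have hms : MeasurableSet (Metric.ball x r ∩ Ω) := Metric.isOpen_ball.measurableSet.inter
      hΩ.measurableSet
    filter_upwards [ae_restrict_mem hms,
      ae_mono (Measure.restrict_mono inter_subset_right le_rfl) hwM] with y hy hwy
    refine le_trans (ENNReal.ofReal_le_ofReal ?_)
      (hr y (Metric.ball_subset_ball hrr.2.le hy.1))
    rw [sub_zero, abs_of_nonneg (mul_nonneg (hψ0 y) (le_max_right _ _))]
    refine mul_le_mul_of_nonneg_left (max_le ?_ ?_) (hψ0 y)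
    · linarith [le_abs_self (w y), neg_abs_le k]
    · linarith [abs_nonneg (w y), abs_nonneg k]

end TestFunction

end DGNeumann

/-! ### The pointwise energy inequality -/

namespace DGNeumann

/-- The weight of the cutoff function in the Young inequality for the density. -/
noncomputable def youngWeight (L a₁ a₄ gp : ℝ) : ℝ := min 1 (a₄ / (4 * (a₁ * L * gp)))

/-- The coefficient of `∫ G(x, |w - k| / (σρ))`, up to the factor `2 / a₄`; `L` is a bound for
`σρ |D(φ^q)| / φ^(q-1)`. -/
noncomputable def energyCoeff (L a₁ a₂ a₃ a₄ gm gp : ℝ) : ℝ :=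
  a₁ * L * (gp * youngWeight L a₁ a₄ gp * (youngWeight L a₁ a₄ gp)⁻¹ ^ gp) +
    (1 + a₂ * L) ^ gp + a₃ * L * (1 + (gm - 1)⁻¹)

/-- The coefficient of `|A_{k,ρ}|`, up to the factor `2 / a₄`. -/
noncomputable def measureCoeff (L a₃ a₄ a₅ a₆ b₁ b₂ b₃ hp F F₁ M : ℝ) : ℝ :=
  a₅ * ((1 + M) ^ hp * F₁) + a₆ + (1 + M) ^ hp * F₁ + a₃ * L * Real.exp F +
    a₄ / 4 * ((1 + 2 * M / (a₄ / (4 * b₁))) ^ hp * F₁) +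
    b₂ * (2 * (hp * ((1 + M) ^ hp * F₁))) + b₃ * (2 * M)

variable {n : ℕ} {G H₁ : E n → ℝ → ℝ} {gm gp hm hp F F₁ M : ℝ}

lemma PowerGrowth.exponent_le {Φ : ℝ → ℝ} {m p : ℝ} (h : PowerGrowth Φ m p) : m ≤ p :=
  (h.lower 1 one_pos).trans (h.upper 1 one_pos)

lemma energyCoeff_pos {L a₁ a₂ a₃ a₄ : ℝ} (hL : 0 < L) (h1 : 0 < a₁) (h2 : 0 < a₂) (h3 : 0 < a₃)
    (h4 : 0 < a₄) (hgm : 1 < gm) (hgp : 0 < gp) : 0 < energyCoeff L a₁ a₂ a₃ a₄ gm gp := by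
  have hκ : 0 < youngWeight L a₁ a₄ gp := lt_min one_pos (by positivity)
  have : 0 < gm - 1 := by linarith
  unfold energyCoeff; positivity

lemma measureCoeff_pos {L a₃ a₄ a₅ a₆ b₁ b₂ b₃ : ℝ} (hL : 0 < L) (h3 : 0 < a₃) (h4 : 0 < a₄)
    (h5 : 0 < a₅) (h6 : 0 < a₆) (hb1 : 0 < b₁) (hb2 : 0 < b₂) (hb3 : 0 < b₃) (hhp : 0 < hp)
    (hF₁ : 0 < F₁) (hM : 0 < M) :
    0 < measureCoeff L a₃ a₄ a₅ a₆ b₁ b₂ b₃ hp F F₁ M := by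
  unfold measureCoeff; positivity

/-- The pointwise inequality behind the Caccioppoli estimate. -/
lemma pointwise_energy (K : Coeffs) {x : E n} (hG : PowerGrowth (G x) gm gp)
    (hH : PowerGrowth (H₁ x) hm hp) (hgm : 1 < gm) (hhp : 0 ≤ hp) (hF : 1 ≤ F)
    (hF1 : F⁻¹ ≤ G x 1) (hF₁ : H₁ x 1 ≤ F₁) {q : ℕ} (hq : 2 ≤ q) (hgq : gp ≤ q) {C : ℝ}
    (hC : 0 < C) {c t s d r α β b N : ℝ} (hc : 0 ≤ c) (hc1 : c ≤ 1) (ht : 0 ≤ t) (hs : 0 ≤ s)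
    (hd : 0 ≤ d) (hdM : d ≤ 2 * M) (hr : 0 ≤ r) (hrM : r ≤ M)
    (hα : K.a₄ * G x t - K.a₅ * H₁ x r - K.a₆ ≤ α)
    (hN : N ≤ K.a₁ * dens G x t + K.a₂ * auxP G H₁ x r + K.a₃)
    (hβ : |d * β| ≤ N * (C * s))
    (hb : |b| ≤ K.b₁ * auxM G H₁ x t + K.b₂ * dens H₁ x r + K.b₃) :
    K.a₄ / 2 * (c ^ q * G x t) ≤ (c ^ q * α + q * c ^ (q - 1) * (d * β) - b * (c ^ q * d)) +
      energyCoeff (q * C) K.a₁ K.a₂ K.a₃ K.a₄ gm gp * G x s +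
      measureCoeff (q * C) K.a₃ K.a₄ K.a₅ K.a₆ K.b₁ K.b₂ K.b₃ hp F F₁ M := by
  -- In the application c = φ, t = |Dw|, r = |w|, d = w - k, s = d/(σρ), N = |A|, α = A·Dw, β = A·Dφ
  -- and b = B, all at the point x.
  obtain ⟨a₁, a₂, a₃, a₄, a₅, a₆, b₁, b₂, b₃, c₁, c₂, h1, h2, h3, h4, h5, h6, hb1, hb2, hb3, _, _⟩ :=
    K
  dsimp only at hα hN hb ⊢
  have hgp : 1 < gp := hgm.trans_le hG.exponent_le
  have hM : 0 ≤ M := hr.trans hrM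
  have hq0 : (0 : ℝ) < q := by exact_mod_cast (by omega : 0 < q)
  set L : ℝ := q * C with hLdef
  have hL : 0 < L := by positivity
  rw [dens_of_nonneg G x ht] at hN
  rw [dens_of_nonneg H₁ x hr] at hb
  set g := derivWithin (G x) (Ici t) t with hg
  set HM := (1 + M) ^ hp * F₁ with hHM
  have hGt := hG.nonneg ht
  have hGs := hG.nonneg hs
  have hHle : ∀ {y Y : ℝ}, 0 ≤ y → y ≤ Y → H₁ x y ≤ (1 + Y) ^ hp * F₁ := by
    intro y Y hy hyY
    have hY : 0 ≤ Y := hy.trans hyY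
    refine (hH.mono hy hY hyY).trans ((hH.le_one_add_rpow hY).trans ?_)
    gcongr
  have hHr : H₁ x r ≤ HM := hHle hr hrM
  have hHr0 : 0 ≤ H₁ x r := hH.nonneg hr
  have hcq : 0 ≤ c ^ q := by positivity
  have hcq1 : c ^ q ≤ 1 := pow_le_one₀ hc hc1
  have hcq' : 0 ≤ c ^ (q - 1) := by positivity
  have hcq1' : c ^ (q - 1) ≤ 1 := pow_le_one₀ hc hc1
  -- the coercive term
  have T0 : a₄ * (c ^ q * G x t) ≤ c ^ q * α + (a₅ * HM + a₆) := by
    have e1 := mul_le_mul_of_nonneg_left hα hcq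
    have e2 : c ^ q * (a₅ * H₁ x r + a₆) ≤ 1 * (a₅ * HM + a₆) := by
      gcongr
    linarith
  -- the growth of the vector field
  set κ := youngWeight L a₁ a₄ gp with hκdef
  have hκ : 0 < κ := lt_min one_pos (by positivity)
  have hκ1 : κ ≤ 1 := min_le_left _ _
  -- The second entry of the minimum in `youngWeight` is chosen so that the vector field costs a
  -- quarter of the coercive term.
  have hκ2 : a₁ * L * gp * κ ≤ a₄ / 4 := by
    have : κ ≤ a₄ / (4 * (a₁ * L * gp)) := min_le_right _ _
    have h' : 0 < a₁ * L * gp := by positivity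
    rw [le_div_iff₀ (by positivity)] at this
    linarith
  have T1 : a₁ * L * (g * c ^ (q - 1) * s) ≤ a₄ / 4 * (c ^ q * G x t) +
      a₁ * L * (gp * κ * κ⁻¹ ^ gp) * G x s := by
    have e1 := mul_le_mul_of_nonneg_left
      (hG.density_mul_pow_mul_le (by linarith) hq hgq hκ hκ1 hc hc1 hs ht)
      (show 0 ≤ a₁ * L by positivity)
    have e2 := mul_le_mul_of_nonneg_right hκ2 (mul_nonneg hcq hGt)
    rw [← hg] at e1
    linarith
  have T2 : a₂ * L * (auxP G H₁ x r * c ^ (q - 1) * s) ≤ HM + (1 + a₂ * L) ^ gp * G x s := by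
    have hP : 0 ≤ auxP G H₁ x r := inv_nonneg _ _
    have e1 : auxP G H₁ x r * (a₂ * L * s) ≤ H₁ x r + G x (a₂ * L * s) :=
      inv_compl_mul_le hG hHr0 (by positivity)
    -- The scaling bound needs a factor at least 1, hence 1 + a₂L.
    have e2 : G x (a₂ * L * s) ≤ (1 + a₂ * L) ^ gp * G x s := by
      refine (hG.mono (mem_Ici.2 (by positivity)) (mem_Ici.2 (by positivity)) ?_).trans
        (hG.scale_le (l := 1 + a₂ * L) (by linarith [mul_pos h2 hL]) hs)
      linarith
    have e3 : auxP G H₁ x r * (a₂ * L * s) * c ^ (q - 1) ≤ auxP G H₁ x r * (a₂ * L * s) :=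
      mul_le_of_le_one_right (by positivity) hcq1'
    linarith
  have T3 : a₃ * L * (c ^ (q - 1) * s) ≤
      a₃ * L * (1 + (gm - 1)⁻¹) * G x s + a₃ * L * Real.exp F := by
    have e1 := hG.le_mul_add_exp hgm hF hF1 hs
    have e2 : c ^ (q - 1) * s ≤ s := mul_le_of_le_one_left hs hcq1'
    have e3 := mul_le_mul_of_nonneg_left (e2.trans e1) (show 0 ≤ a₃ * L by positivity)
    linarith
  have T4 : -(q * c ^ (q - 1) * (d * β)) ≤ a₁ * L * (g * c ^ (q - 1) * s) +
      a₂ * L * (auxP G H₁ x r * c ^ (q - 1) * s) + a₃ * L * (c ^ (q - 1) * s) := by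
    have e1 : -(d * β) ≤ (a₁ * g + a₂ * auxP G H₁ x r + a₃) * (C * s) :=
      (neg_le_abs _).trans (hβ.trans (mul_le_mul_of_nonneg_right hN (by positivity)))
    have e2 := mul_le_mul_of_nonneg_left e1 (show 0 ≤ q * c ^ (q - 1) by positivity)
    rw [hLdef]
    linarith
  -- the lower order term
  set ε := a₄ / (4 * b₁) with hε
  have hε0 : 0 < ε := by positivity
  have hbε : b₁ * ε = a₄ / 4 := by rw [hε]; field_simp
  -- Young's inequality is applied to d/ε, with ε chosen so that b₁ε = a₄/4. The remainder H₁(x,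
  -- d/ε) is a constant because d ≤ 2M.
  have T5 : b₁ * auxM G H₁ x t * d ≤
      a₄ / 4 * G x t + a₄ / 4 * ((1 + 2 * M / ε) ^ hp * F₁) := by
    have e1 : auxM G H₁ x t * (d / ε) ≤ G x t + H₁ x (d / ε) :=
      inv_compl_mul_le hH hGt (by positivity)
    have e2 : H₁ x (d / ε) ≤ (1 + 2 * M / ε) ^ hp * F₁ := hHle (by positivity) (by gcongr)
    have e3 : b₁ * auxM G H₁ x t * d = a₄ / 4 * (auxM G H₁ x t * (d / ε)) := by
      rw [← hbε]; field_simp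
    rw [e3, ← mul_add]
    gcongr
    linarith
  have T6 : derivWithin (H₁ x) (Ici r) r * d ≤ 2 * (hp * HM) := by
    have e1 : derivWithin (H₁ x) (Ici r) r ≤ derivWithin (H₁ x) (Ici M) M := hH.density_mono hrM
    have e2 := hH.density_mul_le hM
    have e3 : H₁ x M ≤ HM := hHle hM le_rfl
    have e4 := mul_le_mul e1 hdM hd (hH.density_nonneg hM)
    have e5 := mul_le_mul_of_nonneg_left e3 hhp
    linarith
  have T7 : b * (c ^ q * d) ≤ a₄ / 4 * (c ^ q * G x t) +
      (a₄ / 4 * ((1 + 2 * M / ε) ^ hp * F₁) + b₂ * (2 * (hp * HM)) + b₃ * (2 * M)) := by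
    have e0 : b * d ≤ a₄ / 4 * G x t + (a₄ / 4 * ((1 + 2 * M / ε) ^ hp * F₁) +
        b₂ * (2 * (hp * HM)) + b₃ * (2 * M)) := by
      have e1 := mul_le_mul_of_nonneg_right ((le_abs_self b).trans hb) hd
      have e2 := mul_le_mul_of_nonneg_left T6 hb2.le
      have e3 := mul_le_mul_of_nonneg_left hdM hb3.le
      linarith
    have hF0 : 0 ≤ F₁ := (hH.nonneg zero_le_one).trans hF₁
    have e1 := mul_le_mul_of_nonneg_left e0 hcq
    have e2 : c ^ q * (a₄ / 4 * ((1 + 2 * M / ε) ^ hp * F₁) +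
        b₂ * (2 * (hp * HM)) + b₃ * (2 * M)) ≤ a₄ / 4 * ((1 + 2 * M / ε) ^ hp * F₁) +
        b₂ * (2 * (hp * HM)) + b₃ * (2 * M) :=
      mul_le_of_le_one_left (by positivity) hcq1
    linarith
  -- Adding up, T1 and T7 each return a₄/4 of the full a₄ supplied by T0, which leaves a₄/2.
  unfold energyCoeff measureCoeff
  rw [← hκdef, ← hHM, ← hε]
  linarith

end DGNeumann

/-! ### The Caccioppoli inequality -/

namespace DGNeumann

variable {n : ℕ}

lemma PowerGrowth.density_mul_le_add {Φ : ℝ → ℝ} {m p : ℝ} (h : PowerGrowth Φ m p) (hp : 0 ≤ p)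
    {t y : ℝ} (ht : 0 ≤ t) (hy : 0 ≤ y) :
    derivWithin Φ (Ici t) t * y ≤ p * (Φ t + Φ y) := by
  have e0 := mul_nonneg hp (h.nonneg ht)
  have e1 := mul_nonneg hp (h.nonneg hy)
  rcases le_total y t with hty | hty
  · have := mul_le_mul_of_nonneg_left hty (h.density_nonneg ht)
    linarith [h.density_mul_le ht]
  · have := mul_le_mul_of_nonneg_right (h.density_mono hty) hy
    have := h.density_mul_le hy
    simp only at *
    linarith

/-- The fields `a = A(x, w, Dw)` and `b = B(x, w, Dw)` of a weak solution `w`, tested with functions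
of zero trace. -/
structure FieldSolution (Ω : Set (E n)) (G H₁ : E n → ℝ → ℝ) (K : Coeffs) (w : E n → ℝ)
    (Dw : E n → E n) (a : E n → E n) (b : E n → ℝ) : Prop where
  meas_a : AEStronglyMeasurable a (volume.restrict Ω)
  meas_b : AEStronglyMeasurable b (volume.restrict Ω)
  coercive : ∀ᵐ x ∂(volume.restrict Ω),
    K.a₄ * G x ‖Dw x‖ - K.a₅ * H₁ x |w x| - K.a₆ ≤ inner ℝ (a x) (Dw x)
  growth_a : ∀ᵐ x ∂(volume.restrict Ω),
    ‖a x‖ ≤ K.a₁ * dens G x ‖Dw x‖ + K.a₂ * auxP G H₁ x |w x| + K.a₃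
  growth_b : ∀ᵐ x ∂(volume.restrict Ω),
    |b x| ≤ K.b₁ * auxM G H₁ x ‖Dw x‖ + K.b₂ * dens H₁ x |w x| + K.b₃
  weak : ∀ (v : E n → ℝ) (Dv : E n → E n), MemW Ω G v Dv → IsTrace Ω v (fun _ => 0) →
    (∫ x in Ω, inner ℝ (a x) (Dv x)) - ∫ x in Ω, b x * v x = 0

variable {Ω : Set (E n)} {G H₁ : E n → ℝ → ℝ} {K : Coeffs} {w : E n → ℝ} {Dw : E n → E n}
  {a : E n → E n} {b : E n → ℝ} {gm gp hm hp F F₁ M : ℝ}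

/-- The bounds involve only |w|, |Dw|, |a|, |b| and a·Dw, all unchanged by a joint change of sign.
Working with the fields instead of A and B thus treats -u without any symmetry of A and B. -/
lemma FieldSolution.neg (h : FieldSolution Ω G H₁ K w Dw a b) :
    FieldSolution Ω G H₁ K (fun x => -w x) (fun x => -Dw x) (fun x => -a x) (fun x => -b x) := by
  refine ⟨h.meas_a.neg, h.meas_b.neg, ?_, ?_, ?_, fun v Dv hv hτ => ?_⟩
  · simpa using h.coercive
  · simpa using h.growth_a
  · simpa using h.growth_b
  · have := h.weak v Dv hv hτ
    simp only [inner_neg_left, neg_mul, integral_neg]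
    linarith

lemma MemW.neg (hG : ∀ᵐ x ∂(volume.restrict Ω), ∀ t, G x (-t) = G x t) (h : MemW Ω G w Dw) :
    MemW Ω G (fun x => -w x) (fun x => -Dw x) := by
  obtain ⟨⟨hm, l, hl, hfin⟩, hgrad, hmg⟩ := h
  refine ⟨⟨hm.neg, l, hl, ?_⟩, hgrad.neg, by simpa using hmg⟩
  rwa [lintegral_congr_ae (g := fun x => ENNReal.ofReal (G x (l * w x)))]
  filter_upwards [hG] with x hx
  rw [mul_neg, hx]

lemma IsTrace.neg {τ : E n → ℝ} (h : IsTrace Ω w τ) :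
    IsTrace Ω (fun x => -w x) (fun x => -τ x) := by
  have : ∀ x y, |-w y - -τ x| = |w y - τ x| := fun x y => by rw [← abs_neg]; ring_nf
  simpa only [IsTrace, this] using h

/-- The standing assumptions on `Ω`, `G` and `H₁` in the energy estimate. -/
structure EnergySetting (Ω : Set (E n)) (G H₁ : E n → ℝ → ℝ) (gm gp hm hp F F₁ : ℝ) : Prop where
  isOpen : IsOpen Ω
  finite : volume Ω ≠ ⊤
  growthG : ∀ᵐ x ∂(volume.restrict Ω), PowerGrowth (G x) gm gp
  growthH : ∀ᵐ x ∂(volume.restrict Ω), PowerGrowth (H₁ x) hm hp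
  caraG : Caratheodory (volume.restrict Ω) G
  one_lt : 1 < gm
  gm_le : gm ≤ gp
  hp_nonneg : 0 ≤ hp
  one_le_F : 1 ≤ F
  boundG : ∀ᵐ x ∂(volume.restrict Ω), F⁻¹ ≤ G x 1 ∧ G x 1 ≤ F
  boundH : ∀ᵐ x ∂(volume.restrict Ω), H₁ x 1 ≤ F₁

namespace EnergySetting

/-- Needed to merge and localize the integrals of the weak formulation, since a Bochner integral is
0 by default when the integrand is not integrable. Young's inequality dominates each growth term of
a times |Dv|. -/
lemma integrableOn_inner (hS : EnergySetting Ω G H₁ gm gp hm hp F F₁)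
    (hsol : FieldSolution Ω G H₁ K w Dw a b) (hw : MemW Ω G w Dw)
    (hwM : ∀ᵐ x ∂(volume.restrict Ω), |w x| ≤ M) {v : E n → ℝ} {Dv : E n → E n}
    (hv : MemW Ω G v Dv) : IntegrableOn (fun x => inner ℝ (a x) (Dv x)) Ω := by
  have hfin : IsFiniteMeasure (volume.restrict Ω) := ⟨by simpa using hS.finite.lt_top⟩
  have i1 := hw.mem_grad.integrableOn hS.growthG hS.caraG
  have i2 := hv.mem_grad.integrableOn hS.growthG hS.caraG
  have hgp : 0 ≤ gp := by linarith [hS.one_lt, hS.gm_le]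
  refine Integrable.mono' (g := fun x => K.a₁ * (gp * (G x ‖Dw x‖ + G x ‖Dv x‖)) +
    K.a₂ * ((1 + M) ^ hp * F₁ + G x ‖Dv x‖) +
    K.a₃ * ((1 + (gm - 1)⁻¹) * G x ‖Dv x‖ + Real.exp F))
    (((((i1.add i2).const_mul _).const_mul _).add
      (((integrable_const _).add i2).const_mul _)).add
        (((i2.const_mul _).add (integrable_const _)).const_mul _))
    (hsol.meas_a.inner hv.grad.locInt_grad.aestronglyMeasurable) ?_
  filter_upwards [hS.growthG, hS.growthH, hS.boundG, hS.boundH, hwM, hsol.growth_a]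
    with x hG hH hF hF₁ hwx ha
  have hM : 0 ≤ M := (abs_nonneg _).trans hwx
  have hHw : H₁ x |w x| ≤ (1 + M) ^ hp * F₁ := by
    refine (hH.mono (mem_Ici.2 (abs_nonneg _)) hM hwx).trans ((hH.le_one_add_rpow hM).trans ?_)
    gcongr
  have hy := norm_nonneg (Dv x)
  have e1 := hG.density_mul_le_add hgp (norm_nonneg (Dw x)) hy
  have e2 : auxP G H₁ x |w x| * ‖Dv x‖ ≤ H₁ x |w x| + G x ‖Dv x‖ :=
    inv_compl_mul_le hG (hH.nonneg (abs_nonneg _)) hy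
  have e3 := hG.le_mul_add_exp hS.one_lt hS.one_le_F hF.1 hy
  rw [dens_of_nonneg G x (norm_nonneg _)] at ha
  have e4 := mul_le_mul_of_nonneg_right ha hy
  have e5 := mul_le_mul_of_nonneg_left e1 K.a₁_pos.le
  have e6 := mul_le_mul_of_nonneg_left (e2.trans (add_le_add_left hHw _)) K.a₂_pos.le
  have e7 := mul_le_mul_of_nonneg_left e3 K.a₃_pos.le
  refine (norm_inner_le_norm _ _).trans ?_
  linarith

lemma integrableOn_mul (hS : EnergySetting Ω G H₁ gm gp hm hp F F₁)
    (hsol : FieldSolution Ω G H₁ K w Dw a b) (hw : MemW Ω G w Dw) (hM : 0 < M)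
    (hwM : ∀ᵐ x ∂(volume.restrict Ω), |w x| ≤ M) {v : E n → ℝ}
    (hvm : AEMeasurable v (volume.restrict Ω)) {V : ℝ}
    (hv : ∀ᵐ x ∂(volume.restrict Ω), |v x| ≤ V) : IntegrableOn (fun x => b x * v x) Ω := by
  have hfin : IsFiniteMeasure (volume.restrict Ω) := ⟨by simpa using hS.finite.lt_top⟩
  have i1 := hw.mem_grad.integrableOn hS.growthG hS.caraG
  refine Integrable.mono' (g := fun x => K.b₁ * (G x ‖Dw x‖ + (1 + V) ^ hp * F₁) +
    (K.b₂ * (hp * ((1 + M) ^ hp * F₁) / M * V) + K.b₃ * V))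
    (((i1.add (integrable_const _)).const_mul _).add (integrable_const _))
    (hsol.meas_b.mul hvm.aestronglyMeasurable) ?_
  filter_upwards [hS.growthG, hS.growthH, hS.boundH, hwM, hv, hsol.growth_b]
    with x hG hH hF₁ hwx hvx hb
  have hV : 0 ≤ V := (abs_nonneg _).trans hvx
  have hHle : ∀ {y Y : ℝ}, 0 ≤ y → y ≤ Y → H₁ x y ≤ (1 + Y) ^ hp * F₁ := by
    intro y Y hy hyY
    have hY : 0 ≤ Y := hy.trans hyY
    refine (hH.mono hy hY hyY).trans ((hH.le_one_add_rpow hY).trans ?_)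
    gcongr
  have e1 : auxM G H₁ x ‖Dw x‖ * |v x| ≤ G x ‖Dw x‖ + H₁ x |v x| :=
    inv_compl_mul_le hH (hG.nonneg (norm_nonneg _)) (abs_nonneg _)
  have e2 : dens H₁ x |w x| ≤ hp * ((1 + M) ^ hp * F₁) / M := by
    rw [dens_of_nonneg H₁ x (abs_nonneg _), le_div_iff₀ hM]
    have h1 := mul_le_mul_of_nonneg_right (hH.density_mono hwx) hM.le
    have h2 := hH.density_mul_le hM.le
    have h3 := mul_le_mul_of_nonneg_left (hHle hM.le le_rfl) hS.hp_nonneg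
    simp only at h1
    linarith
  have e3 : 0 ≤ dens H₁ x |w x| := by
    rw [dens_of_nonneg H₁ x (abs_nonneg _)]; exact hH.density_nonneg (abs_nonneg _)
  have e4 := mul_le_mul_of_nonneg_right hb (abs_nonneg (v x))
  have e5 := mul_le_mul_of_nonneg_left
    (e1.trans (add_le_add_right (hHle (abs_nonneg _) hvx) _)) K.b₁_pos.le
  have e6 := mul_le_mul_of_nonneg_left (mul_le_mul e2 hvx (abs_nonneg _) (e3.trans e2)) K.b₂_pos.le
  have e7 := mul_le_mul_of_nonneg_left hvx K.b₃_pos.le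
  rw [norm_mul, Real.norm_eq_abs, Real.norm_eq_abs]
  linarith

/-- The Caccioppoli inequality on a ball, for levels above the trace. -/
theorem energyIneq (hS : EnergySetting Ω G H₁ gm gp hm hp F F₁)
    (hsol : FieldSolution Ω G H₁ K w Dw a b) (hw : MemW Ω G w Dw) (hM : 0 < M)
    (hwM : ∀ᵐ x ∂(volume.restrict Ω), |w x| ≤ M) {τ : E n → ℝ} (hτ : IsTrace Ω w τ)
    (hF₁ : 0 < F₁) (hhp : 0 < hp) {C : ℝ} (hC : 0 < C) {z : E n} {ρ σ k : ℝ} (hρ : 0 < ρ)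
    (hσ : 0 < σ)
    {φ : E n → ℝ} (hφ : IsCutoff C z ρ σ φ)
    (hwk : ∀ᵐ x ∂(volume.restrict (Metric.ball z ρ ∩ Ω)), w x ≤ k + 2 * M)
    (hk : ∀ᵐ x ∂((surf Ω).restrict (Metric.ball z ρ)), τ x ≤ k) :
    EnergyIneq Ω G (2 / K.a₄ * energyCoeff (⌈gp⌉₊ * C) K.a₁ K.a₂ K.a₃ K.a₄ gm gp)
      (2 / K.a₄ *
        measureCoeff (⌈gp⌉₊ * C) K.a₃ K.a₄ K.a₅ K.a₆ K.b₁ K.b₂ K.b₃ hp F F₁ M)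
      w Dw z ρ σ k := by
  have hfin : IsFiniteMeasure (volume.restrict Ω) := ⟨by simpa using hS.finite.lt_top⟩
  have hgm := hS.one_lt
  have hgp : 1 < gp := hgm.trans_le hS.gm_le
  have hσρ : 0 < σ * ρ := mul_pos hσ hρ
  have ha4 := K.a₄_pos
  -- An integer power keeps φ^q smooth. Since g⁺ > 1, q is at least 2, so φ^(q-1) still vanishes
  -- where φ does.
  set q : ℕ := ⌈gp⌉₊ with hqdef
  have hgq : gp ≤ q := Nat.le_ceil gp
  have hq : 2 ≤ q := by
    have : (1 : ℝ) < q := hgp.trans_le hgq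
    exact_mod_cast this
  have hq0 : (0 : ℝ) < q := by linarith
  set Γ := energyCoeff (q * C) K.a₁ K.a₂ K.a₃ K.a₄ gm gp with hΓ
  set Γ₁ := measureCoeff (q * C) K.a₃ K.a₄ K.a₅ K.a₆ K.b₁ K.b₂ K.b₃ hp F F₁ M with hΓ₁
  have hΓ0 : 0 < Γ := energyCoeff_pos (by positivity) K.a₁_pos K.a₂_pos K.a₃_pos ha4 hgm
    (by linarith)
  have hΓ₁0 : 0 < Γ₁ := measureCoeff_pos (by positivity) K.a₃_pos ha4 K.a₅_pos K.a₆_pos K.b₁_pos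
    K.b₂_pos K.b₃_pos hhp hF₁ hM
  -- the test function
  set ψ : E n → ℝ := fun x => φ x ^ q with hψdef
  have hψ : ContDiff ℝ (⊤ : ℕ∞) ψ := hφ.smooth.pow q
  have hψ0 : ∀ x, 0 ≤ ψ x := fun x => pow_nonneg (hφ.nonneg x) q
  have hψ1 : ∀ x, ψ x ≤ 1 := fun x => pow_le_one₀ (hφ.nonneg x) (hφ.le_one x)
  have hψz : ∀ x, x ∉ Metric.ball z ρ → ψ x = 0 := fun x hx => by
    simp only [hψdef, hφ.eq_zero x hx]; exact zero_pow (by omega)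
  have hgradψ : ∀ x, gradient ψ x = (q * φ x ^ (q - 1)) • gradient φ x := fun x =>
    gradient_pow (hφ.smooth.differentiable (by simp) x) q
  have hgradz : ∀ x, x ∉ Metric.ball z ρ → gradient ψ x = 0 := fun x hx => by
    rw [hgradψ, hφ.eq_zero x hx, zero_pow (by omega)]; simp
  have hgradL : ∀ x, ‖gradient ψ x‖ ≤ q * (C / (σ * ρ)) := fun x => by
    rw [hgradψ, norm_smul, Real.norm_of_nonneg
      (mul_nonneg hq0.le (pow_nonneg (hφ.nonneg x) _))]
    exact mul_le_mul (mul_le_of_le_one_right hq0.le (pow_le_one₀ (hφ.nonneg x) (hφ.le_one x)))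
      (hφ.gradient_le x) (norm_nonneg _) hq0.le
  set v : E n → ℝ := fun x => ψ x * max (w x - k) 0 with hvdef
  set Dv : E n → E n := fun x => ψ x • (if 0 < w x - k then Dw x else 0) +
    max (w x - k) 0 • gradient ψ x with hDvdef
  have hv : MemW Ω G v Dv := memW_cutoff_mul_posPart hS.isOpen hS.finite hS.growthG hS.caraG
    (hS.boundG.mono fun x hx => hx.2) hw hwM hψ hψ0 hψ1 hgradL
  have hvτ : IsTrace Ω v fun _ => 0 := isTrace_zero hS.isOpen hτ hwM hψ.continuous hψ0 hψ1 hψz hk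
  have hvbd : ∀ᵐ x ∂(volume.restrict Ω), |v x| ≤ M + |k| := by
    filter_upwards [hwM] with x hx
    rw [abs_of_nonneg (mul_nonneg (hψ0 x) (le_max_right _ _))]
    refine (mul_le_of_le_one_left (le_max_right _ _) (hψ1 x)).trans (max_le ?_ (by positivity))
    linarith [le_abs_self (w x), neg_abs_le k]
  have iA := hS.integrableOn_inner hsol hw hwM hv
  have iB := hS.integrableOn_mul hsol hw hM hwM hv.mem.1 hvbd
  set I : E n → ℝ := fun x => inner ℝ (a x) (Dv x) - b x * v x with hI
  have hI0 : ∫ x in Ω, I x = 0 := by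
    rw [hI, integral_sub iA iB]; exact hsol.weak v Dv hv hvτ
  have hIi : IntegrableOn I Ω := iA.sub iB
  -- localization to the level set
  have hwm : AEMeasurable w (volume.restrict Ω) := hw.mem.1
  set A : Set (E n) := {x | x ∈ Metric.ball z ρ ∩ Ω ∧ k < w x} with hA
  have hball : MeasurableSet (Metric.ball z ρ ∩ Ω) :=
    Metric.isOpen_ball.measurableSet.inter hS.isOpen.measurableSet
  have hAm : NullMeasurableSet A (volume.restrict Ω) :=
    hball.nullMeasurableSet.inter (nullMeasurableSet_lt aemeasurable_const hwm)
  have hAΩ : A ⊆ Ω := fun x hx => hx.1.2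
  have hν : (volume.restrict Ω).restrict A = volume.restrict A := by
    rw [Measure.restrict_restrict₀ hAm, inter_eq_self_of_subset_left hAΩ]
  have hνle : volume.restrict A ≤ volume.restrict Ω := Measure.restrict_mono hAΩ le_rfl
  have hνfin : IsFiniteMeasure (volume.restrict A) := isFiniteMeasure_of_le _ hνle
  -- Both v and Dv vanish in Ω where w ≤ k and outside the ball, so the tested equation lives on A
  -- alone.
  have hIA : ∫ x in A, I x = 0 := by
    rw [← hν, setIntegral_eq_integral_of_ae_compl_eq_zero, hI0]
    filter_upwards [ae_restrict_mem hS.isOpen.measurableSet] with x hxΩ hxA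
    by_cases hxb : x ∈ Metric.ball z ρ
    · have : w x ≤ k := not_lt.1 fun h => hxA ⟨⟨hxb, hxΩ⟩, h⟩
      simp [hI, hDvdef, hvdef, this, not_lt.2 this]
    · simp [hI, hDvdef, hvdef, hψz x hxb, hgradz x hxb]
  have iG := hw.mem_grad.integrableOn hS.growthG hS.caraG
  have i1 : IntegrableOn (fun x => ψ x * G x ‖Dw x‖) A :=
    (iG.bdd_mul (c := 1) hψ.continuous.aestronglyMeasurable (Eventually.of_forall fun x => by
      rw [Real.norm_of_nonneg (hψ0 x)]; exact hψ1 x)).mono_measure hνle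
  have i2 : IntegrableOn (fun x => G x |(w x - k) / (σ * ρ)|) A := by
    refine Integrable.mono_measure (integrableOn_comp_of_bound hS.finite hS.growthG hS.caraG
      (hS.boundG.mono fun x hx => hx.2)
      (((hwm.sub_const k).div_const (σ * ρ)).norm) (c := (M + |k|) / (σ * ρ)) ?_) hνle
    filter_upwards [hwM] with x hx
    rw [abs_abs, abs_div, abs_of_pos hσρ]
    gcongr
    exact (abs_sub _ _).trans (by linarith)
  have hAball : volume.restrict A ≤ volume.restrict (Metric.ball z ρ ∩ Ω) :=
    Measure.restrict_mono (fun x hx => hx.1) le_rfl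
  have hAmem : ∀ᵐ x ∂(volume.restrict A), x ∈ A := by
    rw [← hν]; exact ae_restrict_mem₀ hAm
  have hpt : ∀ᵐ x ∂(volume.restrict A), K.a₄ / 2 * (ψ x * G x ‖Dw x‖) ≤
      I x + Γ * G x |(w x - k) / (σ * ρ)| + Γ₁ := by
    filter_upwards [hAmem, ae_mono hAball hwk, ae_mono hνle hS.growthG, ae_mono hνle hS.growthH,
      ae_mono hνle hS.boundG, ae_mono hνle hS.boundH, ae_mono hνle hwM,
      ae_mono hνle hsol.coercive, ae_mono hνle hsol.growth_a, ae_mono hνle hsol.growth_b]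
      with x hxA hwkx hG hH hFx hF₁x hwx hco hga hgb
    have hd : 0 < w x - k := sub_pos.2 hxA.2
    have hβ : |(w x - k) * inner ℝ (a x) (gradient φ x)| ≤
        ‖a x‖ * (C * |(w x - k) / (σ * ρ)|) := by
      rw [abs_mul, abs_div, abs_of_pos hσρ]
      have h1 : |inner ℝ (a x) (gradient φ x)| ≤ ‖a x‖ * (C / (σ * ρ)) :=
        (abs_real_inner_le_norm _ _).trans
          (mul_le_mul_of_nonneg_left (hφ.gradient_le x) (norm_nonneg _))
      refine (mul_le_mul_of_nonneg_left h1 (abs_nonneg _)).trans_eq ?_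
      ring
    have key := pointwise_energy K hG hH hgm hS.hp_nonneg hS.one_le_F hFx.1 hF₁x hq hgq hC
      (hφ.nonneg x) (hφ.le_one x) (norm_nonneg (Dw x)) (abs_nonneg ((w x - k) / (σ * ρ))) hd.le
      (by linarith : w x - k ≤ 2 * M) (abs_nonneg (w x)) hwx hco hga hβ hgb
    have hIx : I x = φ x ^ q * inner ℝ (a x) (Dw x) +
        q * φ x ^ (q - 1) * ((w x - k) * inner ℝ (a x) (gradient φ x)) -
        b x * (φ x ^ q * (w x - k)) := by
      simp only [hI, hDvdef, hvdef, if_pos hd, max_eq_left hd.le, inner_add_right, hgradψ,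
        inner_smul_right]
      ring
    rw [hIx]
    exact key
  have hint : K.a₄ / 2 * ∫ x in A, ψ x * G x ‖Dw x‖ ≤
      Γ * (∫ x in A, G x |(w x - k) / (σ * ρ)|) + Γ₁ * volume.real A := by
    have iI : IntegrableOn I A := Integrable.mono_measure hIi hνle
    have i3 : IntegrableOn (fun x => I x + Γ * G x |(w x - k) / (σ * ρ)|) A :=
      iI.add (i2.const_mul Γ)
    have h1 := integral_mono_ae (i1.const_mul (K.a₄ / 2)) (i3.add (integrable_const Γ₁)) hpt
    simp only [Pi.add_apply] at h1
    rw [integral_const_mul, integral_add i3 (integrable_const Γ₁),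
      integral_add iI (i2.const_mul Γ), hIA, integral_const_mul, integral_const, smul_eq_mul,
      measureReal_restrict_apply_univ] at h1
    linarith
  have hint' : ∫ x in A, ψ x * G x ‖Dw x‖ ≤
      2 / K.a₄ * Γ * (∫ x in A, G x |(w x - k) / (σ * ρ)|) + 2 / K.a₄ * Γ₁ * volume.real A := by
    have := mul_le_mul_of_nonneg_left hint (show 0 ≤ 2 / K.a₄ by positivity)
    rw [← mul_assoc, show 2 / K.a₄ * (K.a₄ / 2) = 1 by field_simp] at this
    linarith
  -- conclusion
  have hG0 : ∀ᵐ x ∂(volume.restrict A), ∀ t, 0 ≤ t → 0 ≤ G x t :=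
    (hS.growthG.filter_mono (ae_mono hνle)).mono fun x hx t ht => hx.nonneg ht
  set A' : Set (E n) := {x | x ∈ Metric.ball z (ρ - σ * ρ) ∩ Ω ∧ k < w x} with hA'
  have hA'A : A' ⊆ A := fun x hx =>
    ⟨⟨Metric.ball_subset_ball (by linarith) hx.1.1, hx.1.2⟩, hx.2⟩
  have hA'ball : ∀ᵐ x ∂(volume.restrict A'), x ∈ Metric.ball z (ρ - σ * ρ) :=
    ae_mono (Measure.restrict_mono (fun x hx => hx.1.1) le_rfl)
      (ae_restrict_mem Metric.isOpen_ball.measurableSet)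
  have hfin : volume A ≠ ⊤ := by
    simpa using measure_ne_top (volume.restrict A) univ
  unfold EnergyIneq
  calc ∫⁻ x in A', ENNReal.ofReal (G x ‖Dw x‖)
      = ∫⁻ x in A', ENNReal.ofReal (ψ x * G x ‖Dw x‖) := by
        refine lintegral_congr_ae ?_
        filter_upwards [hA'ball] with x hx
        simp [hψdef, hφ.eq_one x hx]
    _ ≤ ∫⁻ x in A, ENNReal.ofReal (ψ x * G x ‖Dw x‖) := lintegral_mono_set hA'A
    _ = ENNReal.ofReal (∫ x in A, ψ x * G x ‖Dw x‖) := by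
        refine (ofReal_integral_eq_lintegral_ofReal i1 ?_).symm
        filter_upwards [hG0] with x hx
        exact mul_nonneg (hψ0 x) (hx _ (norm_nonneg _))
    _ ≤ ENNReal.ofReal (2 / K.a₄ * Γ * (∫ x in A, G x |(w x - k) / (σ * ρ)|) +
          2 / K.a₄ * Γ₁ * volume.real A) := ENNReal.ofReal_le_ofReal hint'
    _ ≤ ENNReal.ofReal (2 / K.a₄ * Γ * (∫ x in A, G x |(w x - k) / (σ * ρ)|)) +
          ENNReal.ofReal (2 / K.a₄ * Γ₁ * volume.real A) := ENNReal.ofReal_add_le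
    _ = _ := by
        rw [ENNReal.ofReal_mul (by positivity), ENNReal.ofReal_mul (by positivity : 0 ≤ 2 / K.a₄ * Γ₁),
          ofReal_integral_eq_lintegral_ofReal i2, Measure.real, ENNReal.ofReal_toReal hfin]
        filter_upwards [hG0] with x hx
        exact hx _ (abs_nonneg _)

end EnergySetting

end DGNeumann

/-! ### Application to weak solutions of the Neumann problem -/

/-- A weak solution of the Neumann problem belongs to the De Giorgi class of the closed domain. -/
theorem theorem4p21 :
    ∃ (γ : (a₁ a₂ a₃ a₄ gm gp : ℝ) → ℝ)
      (γ₁ : (a₁ a₂ a₃ a₄ a₅ a₆ b₁ b₂ b₃ c₁ c₂ gp hp₁ F F₁ M : ℝ) → ℝ),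
      ∀ (n : ℕ), 2 ≤ n →
      ∀ (Ω : Set (DGNeumann.E n)), DGNeumann.IsBoundedDomain Ω →
      ∀ (G H₁ H₂ : DGNeumann.E n → ℝ → ℝ) (gm gp F F₁ F₂ hm₁ hp₁ hm₂ hp₂ : ℝ),
        DGNeumann.IsGenNFunction Set.univ G →
        DGNeumann.CondG0 G gm gp → DGNeumann.CondG1 G F → DGNeumann.CondG2 G →
        DGNeumann.CondG3 Ω G →
        DGNeumann.CondH Ω G gp H₁ F₁ hm₁ hp₁ → DGNeumann.CondH Ω G gp H₂ F₂ hm₂ hp₂ →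
      ∀ (K : DGNeumann.Coeffs) (A : DGNeumann.E n → ℝ → DGNeumann.E n → DGNeumann.E n)
        (B : DGNeumann.E n → ℝ → DGNeumann.E n → ℝ) (C : DGNeumann.E n → ℝ → ℝ),
        DGNeumann.StructureConds Ω G H₁ H₂ K A B C →
      ∀ (u : DGNeumann.E n → ℝ) (Du : DGNeumann.E n → DGNeumann.E n) (M : ℝ), 0 < M →
        DGNeumann.IsWeakSolution Ω G A B C u Du →
        (∀ᵐ x ∂(MeasureTheory.volume.restrict Ω), |u x| ≤ M) →
        DGNeumann.InDGClosure Ω G M (γ K.a₁ K.a₂ K.a₃ K.a₄ gm gp)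
          (γ₁ K.a₁ K.a₂ K.a₃ K.a₄ K.a₅ K.a₆ K.b₁ K.b₂ K.b₃ K.c₁ K.c₂ gp hp₁ F F₁ M)
          (min (K.a₄ / (4 * K.b₃ * M)) 2) u Du := by
  open DGNeumann in
  -- The cutoff constant is fixed before n and all other data, so γ and γ₁ can be written down
  -- explicitly.
  obtain ⟨C₀, hC₀, hcut⟩ := exists_isCutoff
  refine ⟨fun a₁ a₂ a₃ a₄ gm gp => 2 / a₄ * energyCoeff (⌈gp⌉₊ * C₀) a₁ a₂ a₃ a₄ gm gp,
    fun _ _ a₃ a₄ a₅ a₆ b₁ b₂ b₃ _ _ gp hp₁ F F₁ M =>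
      2 / a₄ * measureCoeff (⌈gp⌉₊ * C₀) a₃ a₄ a₅ a₆ b₁ b₂ b₃ hp₁ F F₁ M, ?_⟩
  intro n hn Ω hΩ G H₁ H₂ gm gp F F₁ F₂ hm₁ hp₁ hm₂ hp₂ hG hG0 hG1 _ _ hH₁ _ K A B C hABC u Du M hM
    hsol huM
  obtain ⟨hu, τ, hτ, hweak⟩ := hsol
  obtain ⟨hgm, hgmp, -, hgd⟩ := hG0
  have hGgrow : ∀ᵐ x ∂(volume.restrict Ω), PowerGrowth (G x) gm gp := by
    have := hG.ae_powerGrowth MeasurableSet.univ fun x _ => hgd x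
    rw [Measure.restrict_univ] at this
    exact ae_restrict_of_ae this
  have hHgrow := hH₁.genN.ae_powerGrowth hΩ.isOpen.measurableSet hH₁.H2
  have hle : volume.restrict Ω ≤ volume.restrict univ := Measure.restrict_mono (subset_univ _) le_rfl
  have hcG : Caratheodory (volume.restrict Ω) G :=
    ⟨fun t => (hG.measurable t).mono_measure hle, ae_mono hle hG.continuous⟩
  have hhm : hm₁ ≤ hp₁ := by
    obtain ⟨x, hx⟩ := hΩ.isConnected.nonempty
    exact (hH₁.H2 x hx 1 one_pos).1.trans (hH₁.H2 x hx 1 one_pos).2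
  have hhp : 0 < hp₁ := by linarith [hH₁.gp_le]
  have hF₁ : 0 < F₁ := by linarith [hH₁.one_lt_F]
  have hS : EnergySetting Ω G H₁ gm gp hm₁ hp₁ F F₁ :=
    { isOpen := hΩ.isOpen
      finite := hΩ.isBounded.measure_lt_top.ne
      growthG := hGgrow
      growthH := hHgrow
      caraG := hcG
      one_lt := hgm
      gm_le := hgmp
      hp_nonneg := hhp.le
      one_le_F := hG1.1
      boundG := ae_restrict_of_ae hG1.2
      boundH := (ae_restrict_mem hΩ.isOpen.measurableSet).mono fun x hx => (hH₁.H1 x hx).2 }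
  have hpair : AEMeasurable (fun x => (u x, Du x)) (volume.restrict Ω) :=
    hu.mem.1.prodMk hu.grad.locInt_grad.aestronglyMeasurable.aemeasurable
  have hfield : FieldSolution Ω G H₁ K u Du (fun x => A x (u x) (Du x))
      (fun x => B x (u x) (Du x)) :=
    { meas_a := (hABC.caraA.aemeasurable_comp hpair).aestronglyMeasurable
      meas_b := (hABC.caraB.aemeasurable_comp hpair).aestronglyMeasurable
      coercive := hABC.condA1.mono fun x hx => hx _ _
      growth_a := hABC.condA2.mono fun x hx => hx _ _
      growth_b := hABC.condB.mono fun x hx => hx _ _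
      -- With trace 0 the boundary integrand C(x,u)·0 vanishes.
      weak := fun v Dv hv hvτ => by simpa using hweak v Dv _ hv hvτ }
  have hneg : MemW Ω G (fun x => -u x) (fun x => -Du x) := hu.neg (hGgrow.mono fun x hx => hx.even)
  have hδ : min (K.a₄ / (4 * K.b₃ * M)) 2 * M ≤ 2 * M := by
    gcongr; exact min_le_right _ _
  have hq : (0 : ℝ) < ⌈gp⌉₊ := by exact_mod_cast Nat.ceil_pos.2 (by linarith)
  have ha4 := K.a₄_pos
  -- An open set is disjoint from its frontier, so on interior balls the condition k ≥ trace holds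
  -- vacuously.
  have hsurf : ∀ (z : E n) (ρ : ℝ), Metric.ball z ρ ⊆ Ω →
      (surf Ω).restrict (Metric.ball z ρ) = 0 := by
    intro z ρ hz
    rw [Measure.restrict_eq_zero, surf, Measure.restrict_apply Metric.isOpen_ball.measurableSet]
    refine measure_mono_null (fun x hx => ?_) measure_empty
    rw [hΩ.isOpen.frontier_eq] at hx
    exact hx.2.2 (hz hx.1)
  have energy : ∀ {w : E n → ℝ} {Dw : E n → E n} {a : E n → E n} {b : E n → ℝ} {τ : E n → ℝ},
      FieldSolution Ω G H₁ K w Dw a b → MemW Ω G w Dw →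
      (∀ᵐ x ∂(volume.restrict Ω), |w x| ≤ M) → IsTrace Ω w τ → ∀ (z : E n) (ρ : ℝ), 0 < ρ →
      ∀ σ : ℝ, 0 < σ → σ < 1 → ∀ k : ℝ,
      (∀ᵐ x ∂(volume.restrict (Metric.ball z ρ ∩ Ω)),
        w x ≤ k + min (K.a₄ / (4 * K.b₃ * M)) 2 * M) →
      (∀ᵐ x ∂((surf Ω).restrict (Metric.ball z ρ)), τ x ≤ k) →
      EnergyIneq Ω G (2 / K.a₄ * energyCoeff (⌈gp⌉₊ * C₀) K.a₁ K.a₂ K.a₃ K.a₄ gm gp)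
        (2 / K.a₄ *
          measureCoeff (⌈gp⌉₊ * C₀) K.a₃ K.a₄ K.a₅ K.a₆ K.b₁ K.b₂ K.b₃ hp₁ F F₁ M)
        w Dw z ρ σ k := by
    intro w Dw a b τ hf hw hwM hτ z ρ hρ σ hσ hσ1 k hwk hk
    obtain ⟨φ, hφ⟩ := hcut n z ρ σ hρ hσ hσ1
    exact hS.energyIneq hf hw hM hwM hτ hF₁ hhp hC₀ hρ hσ hφ
      (hwk.mono fun x hx => hx.trans (by linarith)) hk
  have interior : ∀ {w : E n → ℝ} {Dw : E n → E n} {a : E n → E n} {b : E n → ℝ} {τ : E n → ℝ},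
      FieldSolution Ω G H₁ K w Dw a b → MemW Ω G w Dw →
      (∀ᵐ x ∂(volume.restrict Ω), |w x| ≤ M) → IsTrace Ω w τ →
      InteriorIneq Ω G M (2 / K.a₄ * energyCoeff (⌈gp⌉₊ * C₀) K.a₁ K.a₂ K.a₃ K.a₄ gm gp)
        (2 / K.a₄ *
          measureCoeff (⌈gp⌉₊ * C₀) K.a₃ K.a₄ K.a₅ K.a₆ K.b₁ K.b₂ K.b₃ hp₁ F F₁ M)
        (min (K.a₄ / (4 * K.b₃ * M)) 2) w Dw := by
    intro w Dw a b τ hf hw hwM hτ z ρ hρ hz σ hσ hσ1 k hwk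
    refine energy hf hw hwM hτ z ρ hρ σ hσ hσ1 k ?_ ?_
    · rwa [inter_eq_self_of_subset_left hz]
    · rw [hsurf z ρ hz]; simp
  have huM' : ∀ᵐ x ∂(volume.restrict Ω), |-u x| ≤ M := by simpa using huM
  refine ⟨⟨hM, ?_, ?_, ?_, min_le_right _ _, hu, huM, interior hfield hu huM hτ,
    interior hfield.neg hneg huM' hτ.neg⟩, τ, hτ, ?_, ?_⟩
  · exact mul_pos (by positivity) (energyCoeff_pos (by positivity) K.a₁_pos K.a₂_pos K.a₃_pos ha4
      hgm (by linarith))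
  · exact mul_pos (by positivity) (measureCoeff_pos (by positivity) K.a₃_pos ha4 K.a₅_pos K.a₆_pos
      K.b₁_pos K.b₂_pos K.b₃_pos hhp hF₁ hM)
  · exact lt_min (div_pos ha4 (mul_pos (mul_pos four_pos K.b₃_pos) hM)) two_pos
  · exact fun z ρ hρ _ σ hσ hσ1 k => energy hfield hu huM hτ z ρ hρ σ hσ hσ1 k
  · exact fun z ρ hρ _ σ hσ hσ1 k => energy hfield.neg hneg huM' hτ.neg z ρ hρ σ hσ hσ1 k
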